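/- There exist constants $C, C_1, C_2, \rho_0 > 0$ and an integer $N_0$ such that for every real number $\rho \ge \rho_0$ and every integer $N \ge N_0$ there exist a function $u \in \mathcal{C}^2(\mathbb{R}^2,\mathbb{C})$ and a measurable function $W : \mathbb{R}^2 \to \mathbb{C}$ with $$\Delta u + W u = 0 \quad\text{on } \mathbb{R}^2$$ such that - $C_2 |x|^{-N} \le |u(x)| \le C_1 |x|^{-N}$ for all $x \in \mathbb{R}^2$ with $|x| \ge \rho + 6$; - $\|W\|_{L^\infty(\mathbb{R}^2)} \le C N^{3/2}$; - the (closed) support of $W$ is contained in the annulus $\{x \in \mathbb{R}^2 : \rho/2 < |x| \le \rho + 6\}$. The constants $C, C_1, C_2$ do not depend on $\rho$ or $N$. -/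

import Mathlib

open MeasureTheory
open scoped ENNReal InnerProductSpace

/-!
The construction is Meshkov's, carried out on the cylinder `ℂ / 2πiℤ` with coordinate
`w = log z = t + i y`. There the Laplacian of the plane becomes `|z|⁻²` times the flat one
(`laplacian_comp_holomorphic`, `exists_plane_function`), and the task is to pass, on a strip of
`t`-width at most `1 / 4`, from a harmonic function of `exp w` to a multiple of `exp (-N w)`, with
`|Δ v| ≤ C N ^ (3 / 2) |v|`. Placed at `t = log (3 ρ / 4)`, the strip corresponds to an annulus
contained in `3 ρ / 4 ≤ |x| ≤ ρ`, where the conformal factor `|z|⁻²` is at most `1`; this is why no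
constant depends on `ρ`. The potential is then `W = -Δ u / u`.

Changing the frequency at once from `N` to `-N` would cost a potential of size `N ^ 2`. Instead the
frequency is raised in about `√N` steps of size `k ≈ √N`, each on a strip of width `6 / k`. A step
passes from `exp (-n w)` to a wave that decays at rate `n - k` and turns in the *opposite*
direction at frequency `n + k`. The second wave decays more slowly, so it takes over as `t` grows,
and it is nearly harmonic: the squares of the frequencies cancel and leave a potential of size
`n k`, about `N ^ (3 / 2)` (`norm_wavePotential_le`). Afterwards its decay rate is raised to `n + k`
at the same cost, and it has become antiholomorphic.

The one danger is the circle where the two waves have the same modulus, on which their sum has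
`2 n + k` zeros: there the Laplacian must vanish too. A sawtooth modulation of the phase makes the
frequency of the second wave exactly `n - k` near these zeros, so that both waves are harmonic there
(`wavePotential_eq_zero`), while elsewhere the two phases stay apart and the sum is bounded below by
either wave (`norm_laplacian_stepWave_le`). Iterating the step (`exists_isTransition_step`), with a
complex conjugation each time to restore the orientation, yields `exists_isTransition`.
-/

/-! ### The Laplacian on the complex plane -/

theorem laplacian_complex_eq_fderiv (f : ℂ → ℂ) (w : ℂ) :
    Laplacian.laplacian f w
      = fderiv ℝ (fderiv ℝ f) w 1 1 + fderiv ℝ (fderiv ℝ f) w Complex.I Complex.I := by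
  rw [InnerProductSpace.laplacian_eq_iteratedFDeriv_complexPlane]
  simp [iteratedFDeriv_two_apply]

theorem fderiv_fderiv_apply_eq {E : Type*} [NormedAddCommGroup E] [NormedSpace ℝ E]
    {f : E → ℂ} {x : E} (hf : ContDiffAt ℝ 2 f x) (v : E) :
    fderiv ℝ (fderiv ℝ f) x v v = fderiv ℝ (fun y => fderiv ℝ f y v) x v := by
  have h : DifferentiableAt ℝ (fderiv ℝ f) x :=
    (hf.fderiv_right (m := 1) (by norm_num)).differentiableAt (by norm_num)
  rw [fderiv_clm_apply h (differentiableAt_const v)]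
  simp

theorem continuous_laplacian {E : Type*} [NormedAddCommGroup E] [InnerProductSpace ℝ E]
    [FiniteDimensional ℝ E] {f : E → ℂ} (hf : ContDiff ℝ 2 f) :
    Continuous (Laplacian.laplacian f) := by
  rw [InnerProductSpace.laplacian_eq_iteratedFDeriv_stdOrthonormalBasis]
  have h := hf.continuous_iteratedFDeriv (m := 2) le_rfl
  refine continuous_finsetSum _ fun i _ => ?_
  exact (ContinuousMultilinearMap.apply ℝ (fun _ : Fin 2 => E) ℂ
    ![(stdOrthonormalBasis ℝ E) i, (stdOrthonormalBasis ℝ E) i]).continuous.comp h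

/-- The Laplacian of a function written in Cartesian coordinates, from its unmixed second
partials. -/
theorem laplacian_eq_of_partials {F Ft Ftt Fy Fyy : ℝ → ℝ → ℂ}
    (hF : ContDiff ℝ 2 (fun w : ℂ => F w.re w.im))
    (ht : ∀ t y, HasDerivAt (fun s => F s y) (Ft t y) t)
    (htt : ∀ t y, HasDerivAt (fun s => Ft s y) (Ftt t y) t)
    (hy : ∀ t y, HasDerivAt (fun s => F t s) (Fy t y) y)
    (hyy : ∀ t y, HasDerivAt (fun s => Fy t s) (Fyy t y) y) (w : ℂ) :
    Laplacian.laplacian (fun w : ℂ => F w.re w.im) w = Ftt w.re w.im + Fyy w.re w.im := by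
  set f : ℂ → ℂ := fun w : ℂ => F w.re w.im with hf
  have key : ∀ (g : ℂ → ℂ) (w v : ℂ), DifferentiableAt ℝ g w →
      HasDerivAt (fun s : ℝ => g (w + s • v)) (fderiv ℝ g w v) 0 := by
    intro g w v hg
    exact hg.hasFDerivAt.hasLineDerivAt v
  have hd : Differentiable ℝ f := hF.differentiable (by norm_num)
  have hdd : ∀ v, Differentiable ℝ (fun y => fderiv ℝ f y v) := fun v =>
    ((hF.fderiv_right (m := 1) (by norm_num)).differentiable (by norm_num)).clm_apply
      (differentiable_const v)
  have e1 : (fun y => fderiv ℝ f y 1) = fun w : ℂ => Ft w.re w.im := by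
    funext w
    refine (key f w 1 (hd w)).unique ?_
    have h := ht (w.re + 0) w.im
    have := (h.scomp (h := fun s : ℝ => w.re + s) 0 ((hasDerivAt_id 0).const_add w.re))
    simpa [Function.comp_def, hf] using this
  have e2 : (fun y => fderiv ℝ f y Complex.I) = fun w : ℂ => Fy w.re w.im := by
    funext w
    refine (key f w Complex.I (hd w)).unique ?_
    have h := hy w.re (w.im + 0)
    have := (h.scomp (h := fun s : ℝ => w.im + s) 0 ((hasDerivAt_id 0).const_add w.im))
    simpa [Function.comp_def, hf] using this
  rw [laplacian_complex_eq_fderiv, fderiv_fderiv_apply_eq hF.contDiffAt,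
    fderiv_fderiv_apply_eq hF.contDiffAt]
  congr 1
  · refine (key _ w 1 (hdd 1 w)).unique ?_
    have e : ∀ z, fderiv ℝ f z 1 = Ft z.re z.im := fun z => congrFun e1 z
    simp only [e]
    have h := htt (w.re + 0) w.im
    have := (h.scomp (h := fun s : ℝ => w.re + s) 0 ((hasDerivAt_id 0).const_add w.re))
    simpa [Function.comp_def, hf] using this
  · refine (key _ w Complex.I (hdd _ w)).unique ?_
    have e : ∀ z, fderiv ℝ f z Complex.I = Fy z.re z.im := fun z => congrFun e2 z
    simp only [e]
    have h := hyy w.re (w.im + 0)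
    have := (h.scomp (h := fun s : ℝ => w.im + s) 0 ((hasDerivAt_id 0).const_add w.im))
    simpa [Function.comp_def, hf] using this

theorem laplacian_comp_sub_const (f : ℂ → ℂ) (a w : ℂ) :
    Laplacian.laplacian (fun z => f (z - a)) w = Laplacian.laplacian f (w - a) := by
  rw [InnerProductSpace.laplacian_eq_iteratedFDeriv_complexPlane,
    InnerProductSpace.laplacian_eq_iteratedFDeriv_complexPlane]
  simp only [iteratedFDeriv_comp_sub]

/-- The Laplacian commutes with linear isometries of the domain. -/
theorem laplacian_comp_linearIsometryEquiv {E : Type*} [NormedAddCommGroup E]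
    [InnerProductSpace ℝ E] [FiniteDimensional ℝ E] (e : E ≃ₗᵢ[ℝ] ℂ) {f : ℂ → ℂ}
    (hf : ContDiff ℝ 2 f) (x : E) :
    Laplacian.laplacian (fun y => f (e y)) x = Laplacian.laplacian f (e x) := by
  rw [InnerProductSpace.laplacian_eq_iteratedFDeriv_orthonormalBasis _ (stdOrthonormalBasis ℝ E),
    InnerProductSpace.laplacian_eq_iteratedFDeriv_orthonormalBasis _
      ((stdOrthonormalBasis ℝ E).map e)]
  have h := ContinuousLinearMap.iteratedFDeriv_comp_right (𝕜 := ℝ)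
    (e.toContinuousLinearEquiv : E →L[ℝ] ℂ) hf x (i := 2) le_rfl
  have h' : iteratedFDeriv ℝ 2 (fun y => f (e y)) x = _ := h
  simp only [h']
  refine Finset.sum_congr rfl fun i _ => ?_
  simp only [ContinuousMultilinearMap.compContinuousLinearMap_apply]
  congr 1
  funext j
  fin_cases j <;> simp

/-- Precomposition with a holomorphic map multiplies the Laplacian by the squared modulus of the
complex derivative. -/
theorem laplacian_comp_holomorphic {f h h₁ : ℂ → ℂ} {h₂ z : ℂ} (hf : ContDiff ℝ 2 f)
    (hh : ∀ᶠ y in nhds z, HasDerivAt h (h₁ y) y) (hh₁ : HasDerivAt h₁ h₂ z)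
    (hc : ContDiffAt ℝ 2 h z) :
    Laplacian.laplacian (fun y => f (h y)) z
      = (‖h₁ z‖ ^ 2 : ℝ) * Laplacian.laplacian f (h z) := by
  have hdf : Differentiable ℝ f := hf.differentiable (by norm_num)
  have hddf : Differentiable ℝ (fderiv ℝ f) :=
    (hf.fderiv_right (m := 1) (by norm_num)).differentiable (by norm_num)
  have hcomp : ContDiffAt ℝ 2 (fun y => f (h y)) z := hf.contDiffAt.comp z hc
  have second : ∀ v : ℂ, fderiv ℝ (fderiv ℝ fun y => f (h y)) z v v
      = fderiv ℝ (fderiv ℝ f) (h z) (h₁ z * v) (h₁ z * v) + fderiv ℝ f (h z) (h₂ * v * v) := by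
    intro v
    rw [fderiv_fderiv_apply_eq hcomp]
    have e : (fun y => fderiv ℝ (fun y => f (h y)) y v)
        =ᶠ[nhds z] fun y => fderiv ℝ f (h y) (h₁ y * v) := by
      filter_upwards [hh] with y hy
      have h0 : HasFDerivAt (fun y => f (h y)) _ y :=
        (hdf (h y)).hasFDerivAt.comp y (hy.hasFDerivAt.restrictScalars ℝ)
      rw [h0.fderiv]
      simp [mul_comm]
    rw [e.fderiv_eq]
    have a1 : HasFDerivAt h _ z := (hh.self_of_nhds).hasFDerivAt.restrictScalars ℝ
    have a2 : HasFDerivAt (fun y => h₁ y * v) _ z :=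
      (hh₁.mul_const v).hasFDerivAt.restrictScalars ℝ
    have a3 := ((hddf (h z)).hasFDerivAt.comp z a1).clm_apply a2
    have a4 := a3.fderiv
    simp only [Function.comp_def] at a4
    rw [a4]
    simp [mul_comm, mul_left_comm, add_comm]
  rw [laplacian_complex_eq_fderiv, laplacian_complex_eq_fderiv, second, second]
  set B := fderiv ℝ (fderiv ℝ f) (h z)
  set p := h₁ z
  have e1 : p * 1 = p.re • (1 : ℂ) + p.im • Complex.I := by
    apply Complex.ext <;> simp
  have e2 : p * Complex.I = (-p.im) • (1 : ℂ) + p.re • Complex.I := by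
    apply Complex.ext <;> simp
  have e3 : h₂ * Complex.I * Complex.I = -(h₂ * 1 * 1) := by
    rw [mul_assoc, Complex.I_mul_I]; ring
  rw [e1, e2, e3, Complex.sq_norm, Complex.normSq_apply, map_neg]
  simp only [map_add, map_smul, add_apply, smul_apply]
  simp only [Complex.real_smul]
  push_cast
  ring

/-! ### From the cylinder to the plane -/

theorem periodic_eq_of_exp_eq {v : ℂ → ℂ} (hv : Function.Periodic v (2 * Real.pi * Complex.I))
    {a b : ℂ} (h : Complex.exp a = Complex.exp b) : v a = v b := by
  obtain ⟨n, rfl⟩ := Complex.exp_eq_exp_iff_exists_int.1 h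
  exact hv.int_mul n b

/-- Near every nonzero point a periodic function of the logarithm is a function of a local
holomorphic branch, which gives its regularity and its Laplacian. -/
theorem contDiffAt_comp_log {v : ℂ → ℂ} (hv : ContDiff ℝ 2 v)
    (hp : Function.Periodic v (2 * Real.pi * Complex.I)) {z : ℂ} (hz : z ≠ 0) :
    ContDiffAt ℝ 2 (fun y => v (Complex.log y)) z ∧
      Laplacian.laplacian (fun y => v (Complex.log y)) z
        = ((‖z‖ ^ 2)⁻¹ : ℝ) * Laplacian.laplacian v (Complex.log z) := by
  -- the branch of the logarithm around `z` that agrees with `Complex.log` at `z`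
  set b : ℂ → ℂ := fun y => Complex.log (y / z) + Complex.log z with hb
  have hslit : ∀ᶠ y in nhds z, y / z ∈ Complex.slitPlane := by
    have : ContinuousAt (fun y => y / z) z := by fun_prop
    refine this.eventually_mem (Complex.isOpen_slitPlane.mem_nhds ?_)
    simp [hz]
  have hne : ∀ᶠ y in nhds z, y ≠ 0 := isOpen_ne.mem_nhds hz
  have hd : ∀ᶠ y in nhds z, HasDerivAt b (y⁻¹) y := by
    filter_upwards [hslit, hne] with y hy hy0
    have := (((hasDerivAt_id y).div_const z).clog hy).add_const (Complex.log z)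
    refine this.congr_deriv ?_
    simp only [id]
    field_simp
  have hbz : b z = Complex.log z := by simp [hb, hz]
  have heq : (fun y => v (Complex.log y)) =ᶠ[nhds z] fun y => v (b y) := by
    filter_upwards [hne] with y hy
    apply periodic_eq_of_exp_eq hp
    rw [hb]
    simp only [Complex.exp_add]
    rw [Complex.exp_log hy, Complex.exp_log hz, Complex.exp_log (div_ne_zero hy hz)]
    field_simp
  have hc : ContDiffAt ℝ 2 b z := by
    have h1 : ContDiffAt ℂ 2 b z :=
      (ContDiffAt.comp (g := Complex.log) (f := fun y => y / z) z
        (Complex.contDiffAt_log hslit.self_of_nhds) (contDiffAt_id.div_const z)).add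
        contDiffAt_const
    exact h1.restrict_scalars ℝ
  refine ⟨(hv.contDiffAt.comp z hc).congr_of_eventuallyEq heq, ?_⟩
  rw [(InnerProductSpace.laplacian_congr_nhds heq).self_of_nhds,
    laplacian_comp_holomorphic hv hd (hasDerivAt_inv hz) hc, hbz]
  simp

/-- A periodic function `v` on the cylinder which, on its left end, is a harmonic function `p` of
the plane in the coordinate `exp w`, descends to a `C²` function of the plane. -/
theorem exists_plane_function {v p : ℂ → ℂ} {T : ℝ} (hv : ContDiff ℝ 2 v)
    (hper : Function.Periodic v (2 * Real.pi * Complex.I)) (hp : ContDiff ℝ 2 p)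
    (hpΔ : ∀ z, Laplacian.laplacian p z = 0)
    (hvp : ∀ w : ℂ, w.re ≤ T → v w = p (Complex.exp w)) :
    ∃ u : ℂ → ℂ, ContDiff ℝ 2 u ∧ (∀ z, z ≠ 0 → u z = v (Complex.log z)) ∧
      (∀ z, ‖z‖ < Real.exp T → Laplacian.laplacian u z = 0) ∧
      (∀ z, z ≠ 0 → Laplacian.laplacian u z
        = ((‖z‖ ^ 2)⁻¹ : ℝ) * Laplacian.laplacian v (Complex.log z)) := by
  classical
  set u : ℂ → ℂ := fun z => if z = 0 then p 0 else v (Complex.log z) with hu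
  have hu1 : ∀ z, z ≠ 0 → u z = v (Complex.log z) := fun z hz => by simp [hu, hz]
  have hu2 : ∀ z, ‖z‖ < Real.exp T → u z = p z := by
    intro z hz
    by_cases h0 : z = 0
    · simp [hu, h0]
    · rw [hu1 z h0, hvp, Complex.exp_log h0]
      rw [Complex.log_re]
      exact ((Real.log_lt_iff_lt_exp (norm_pos_iff.2 h0)).2 hz).le
  have near1 : ∀ z, z ≠ 0 → u =ᶠ[nhds z] fun y => v (Complex.log y) := fun z hz => by
    filter_upwards [isOpen_ne.mem_nhds hz] with y hy using hu1 y hy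
  have near2 : ∀ z, ‖z‖ < Real.exp T → u =ᶠ[nhds z] p := fun z hz => by
    filter_upwards [(isOpen_lt continuous_norm continuous_const).mem_nhds hz] with y hy
      using hu2 y hy
  refine ⟨u, contDiff_iff_contDiffAt.2 fun z => ?_, hu1, fun z hz => ?_, fun z hz => ?_⟩
  · by_cases h0 : z = 0
    · exact hp.contDiffAt.congr_of_eventuallyEq (near2 z (by simp [h0, Real.exp_pos]))
    · exact (contDiffAt_comp_log hv hper h0).1.congr_of_eventuallyEq (near1 z h0)
  · rw [(InnerProductSpace.laplacian_congr_nhds (near2 z hz)).self_of_nhds, hpΔ]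
  · rw [(InnerProductSpace.laplacian_congr_nhds (near1 z hz)).self_of_nhds,
      (contDiffAt_comp_log hv hper hz).2]

/-! ### Profile functions -/

/-- A continuous function that is constant near `-∞` and near `+∞` is bounded. -/
theorem exists_bound_of_eq_const {g : ℝ → ℝ} (hg : Continuous g) {a b c d : ℝ}
    (hl : ∀ s, s < a → g s = c) (hr : ∀ s, b < s → g s = d) : ∃ B, ∀ s, |g s| ≤ B := by
  obtain ⟨B, hB⟩ := (isCompact_Icc (a := a) (b := b)).exists_bound_of_continuousOn hg.continuousOn
  refine ⟨max B (max |c| |d|), fun s => ?_⟩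
  rcases lt_or_ge s a with h | h
  · rw [hl s h]; exact le_max_of_le_right (le_max_left _ _)
  rcases lt_or_ge b s with h' | h'
  · rw [hr s h']; exact le_max_of_le_right (le_max_right _ _)
  · exact le_max_of_le_left (hB s ⟨h, h'⟩)

theorem exists_bound_of_periodic {g : ℝ → ℝ} (hg : Continuous g)
    (hp : Function.Periodic g (2 * Real.pi)) : ∃ B, ∀ s, |g s| ≤ B := by
  obtain ⟨B, hB⟩ := (isCompact_Icc (a := 0) (b := 2 * Real.pi)).exists_bound_of_continuousOn
    hg.continuousOn
  refine ⟨B, fun s => ?_⟩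
  obtain ⟨y, hy, h⟩ := hp.exists_mem_Ico₀ (by positivity) s
  rw [h]
  exact hB y ⟨hy.1, hy.2.le⟩

theorem deriv_eq_of_eqOn_Iio {g k : ℝ → ℝ} {a : ℝ} (h : ∀ s, s < a → g s = k s) {s : ℝ}
    (hs : s < a) : deriv g s = deriv k s := by
  apply Filter.EventuallyEq.deriv_eq
  filter_upwards [isOpen_Iio.mem_nhds hs] with y hy using h y hy

theorem deriv_eq_of_eqOn_Ioi {g k : ℝ → ℝ} {a : ℝ} (h : ∀ s, a < s → g s = k s) {s : ℝ}
    (hs : a < s) : deriv g s = deriv k s := by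
  apply Filter.EventuallyEq.deriv_eq
  filter_upwards [isOpen_Ioi.mem_nhds hs] with y hy using h y hy

/-- The derivative of the smooth step. -/
noncomputable def step₁ : ℝ → ℝ := deriv Real.smoothTransition

/-- The second derivative of the smooth step. -/
noncomputable def step₂ : ℝ → ℝ := deriv step₁

theorem contDiff_step₁ : ContDiff ℝ 1 step₁ :=
  ((contDiff_succ_iff_deriv (n := 1)).1
    (Real.smoothTransition.contDiff (n := 2))).2.2

theorem hasDerivAt_step (s : ℝ) : HasDerivAt Real.smoothTransition (step₁ s) s :=
  ((Real.smoothTransition.contDiff (n := 1)).differentiable (by norm_num) s).hasDerivAt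

theorem hasDerivAt_step₁ (s : ℝ) : HasDerivAt step₁ (step₂ s) s :=
  (contDiff_step₁.differentiable (by norm_num) s).hasDerivAt

theorem step₁_of_neg {s : ℝ} (hs : s < 0) : step₁ s = 0 := by
  rw [step₁, deriv_eq_of_eqOn_Iio (k := fun _ => 0)
    (fun s hs => Real.smoothTransition.zero_of_nonpos hs.le) hs]
  simp

theorem step₁_of_one_lt {s : ℝ} (hs : 1 < s) : step₁ s = 0 := by
  rw [step₁, deriv_eq_of_eqOn_Ioi (k := fun _ => 1)
    (fun s hs => Real.smoothTransition.one_of_one_le hs.le) hs]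
  simp

theorem step₂_of_neg {s : ℝ} (hs : s < 0) : step₂ s = 0 := by
  rw [step₂, deriv_eq_of_eqOn_Iio (k := fun _ => 0) (fun s hs => step₁_of_neg hs) hs]
  simp

theorem step₂_of_one_lt {s : ℝ} (hs : 1 < s) : step₂ s = 0 := by
  rw [step₂, deriv_eq_of_eqOn_Ioi (k := fun _ => 0) (fun s hs => step₁_of_one_lt hs) hs]
  simp

theorem exists_bound_step : ∃ B, ∀ s, |step₁ s| ≤ B ∧ |step₂ s| ≤ B := by
  obtain ⟨B₁, h₁⟩ := exists_bound_of_eq_const contDiff_step₁.continuous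
    (fun s hs => step₁_of_neg hs) (fun s hs => step₁_of_one_lt hs)
  obtain ⟨B₂, h₂⟩ := exists_bound_of_eq_const
    (contDiff_step₁.continuous_deriv le_rfl : Continuous step₂)
    (fun s hs => step₂_of_neg hs) (fun s hs => step₂_of_one_lt hs)
  exact ⟨max B₁ B₂, fun s => ⟨le_max_of_le_left (h₁ s), le_max_of_le_right (h₂ s)⟩⟩

/-- A smooth ramp: `0` for `s ≤ 2` and `s` for `3 ≤ s`. -/
noncomputable def ramp (s : ℝ) : ℝ := s * Real.smoothTransition (s - 2)

/-- The derivative of the ramp. -/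
noncomputable def ramp₁ (s : ℝ) : ℝ := Real.smoothTransition (s - 2) + s * step₁ (s - 2)

/-- The second derivative of the ramp. -/
noncomputable def ramp₂ (s : ℝ) : ℝ := 2 * step₁ (s - 2) + s * step₂ (s - 2)

theorem hasDerivAt_ramp (s : ℝ) : HasDerivAt ramp (ramp₁ s) s := by
  have h := (hasDerivAt_step (s - 2)).comp_sub_const s 2
  exact ((hasDerivAt_id s).mul h).congr_deriv (by simp [ramp₁])

theorem hasDerivAt_ramp₁ (s : ℝ) : HasDerivAt ramp₁ (ramp₂ s) s := by
  have h := (hasDerivAt_step (s - 2)).comp_sub_const s 2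
  have h₁ := (hasDerivAt_step₁ (s - 2)).comp_sub_const s 2
  exact (h.add ((hasDerivAt_id s).mul h₁)).congr_deriv (by simp only [ramp₂, id]; ring)

theorem contDiff_ramp : ContDiff ℝ 2 ramp :=
  contDiff_id.mul (Real.smoothTransition.contDiff.comp (contDiff_id.sub contDiff_const))

theorem ramp_of_le {s : ℝ} (hs : s ≤ 2) : ramp s = 0 := by
  simp [ramp, Real.smoothTransition.zero_of_nonpos (sub_nonpos.2 hs)]

theorem ramp_of_ge {s : ℝ} (hs : 3 ≤ s) : ramp s = s := by
  simp [ramp, Real.smoothTransition.one_of_one_le (by linarith : 1 ≤ s - 2)]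

theorem ramp₁_of_lt {s : ℝ} (hs : s < 2) : ramp₁ s = 0 := by
  simp [ramp₁, Real.smoothTransition.zero_of_nonpos (sub_nonpos.2 hs.le),
    step₁_of_neg (sub_neg.2 hs)]

theorem ramp₂_of_lt {s : ℝ} (hs : s < 2) : ramp₂ s = 0 := by
  simp [ramp₂, step₂_of_neg (sub_neg.2 hs), step₁_of_neg (sub_neg.2 hs)]

theorem exists_bound_ramp : ∃ B, ∀ s, |ramp₁ s| ≤ B ∧ |ramp₂ s| ≤ B := by
  have c₁ : Continuous ramp₁ := continuous_iff_continuousAt.2 fun s =>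
    (hasDerivAt_ramp₁ s).continuousAt
  have c₂ : Continuous ramp₂ := by
    have e₁ := contDiff_step₁.continuous
    have e₂ : Continuous step₂ := contDiff_step₁.continuous_deriv le_rfl
    unfold ramp₂
    fun_prop
  obtain ⟨B₁, h₁⟩ := exists_bound_of_eq_const c₁ (a := 2) (b := 3) (c := 0) (d := 1)
    (fun s hs => ramp₁_of_lt hs) (fun s hs => by
      simp [ramp₁, Real.smoothTransition.one_of_one_le (by linarith : 1 ≤ s - 2),
        step₁_of_one_lt (by linarith : 1 < s - 2)])
  obtain ⟨B₂, h₂⟩ := exists_bound_of_eq_const c₂ (a := 2) (b := 3) (c := 0) (d := 0)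
    (fun s hs => ramp₂_of_lt hs) (fun s hs => by
      simp [ramp₂, step₂_of_one_lt (by linarith : 1 < s - 2),
        step₁_of_one_lt (by linarith : 1 < s - 2)])
  exact ⟨max B₁ B₂, fun s => ⟨le_max_of_le_left (h₁ s), le_max_of_le_right (h₂ s)⟩⟩

/-- A smooth `2π`-periodic sawtooth: `x ↦ -x` near `0`, and between `-x` and `0` on `[-π, π]`.
The cutoff vanishes where `|sin x|` is near `1`, where `arcsin` fails to be smooth. -/
noncomputable def saw (x : ℝ) : ℝ :=
  -(Real.arcsin (Real.sin x) * Real.smoothTransition (2 - 4 * Real.sin x ^ 2))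

theorem contDiff_saw : ContDiff ℝ 2 saw := by
  have h : ContDiff ℝ 2 fun s : ℝ => Real.arcsin s * Real.smoothTransition (2 - 4 * s ^ 2) := by
    rw [contDiff_iff_contDiffAt]
    intro s
    by_cases hs : s ^ 2 < 1
    · have h1 : s ≠ -1 := by rintro rfl; norm_num at hs
      have h2 : s ≠ 1 := by rintro rfl; norm_num at hs
      refine (Real.contDiffAt_arcsin h1 h2).mul ?_
      exact (Real.smoothTransition.contDiff.comp
        (contDiff_const.sub (contDiff_const.mul (contDiff_id.pow 2)))).contDiffAt
    · have : (fun s : ℝ => Real.arcsin s * Real.smoothTransition (2 - 4 * s ^ 2))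
          =ᶠ[nhds s] fun _ => 0 := by
        have ho : IsOpen {s : ℝ | 1 / 2 < s ^ 2} :=
          isOpen_lt continuous_const (continuous_pow 2)
        filter_upwards [ho.mem_nhds (by simp only [Set.mem_ofPred_eq]; linarith)] with y hy
        have hy' : 1 / 2 < y ^ 2 := hy
        rw [Real.smoothTransition.zero_of_nonpos (by linarith), mul_zero]
      exact contDiffAt_const.congr_of_eventuallyEq this
  exact (h.comp Real.contDiff_sin).neg

theorem saw_periodic : Function.Periodic saw (2 * Real.pi) := fun x => by
  simp [saw]

/-- The derivative of the sawtooth. -/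
noncomputable def saw₁ : ℝ → ℝ := deriv saw

/-- The second derivative of the sawtooth. -/
noncomputable def saw₂ : ℝ → ℝ := deriv saw₁

theorem contDiff_saw₁ : ContDiff ℝ 1 saw₁ :=
  ((contDiff_succ_iff_deriv (n := 1)).1 contDiff_saw).2.2

theorem hasDerivAt_saw (s : ℝ) : HasDerivAt saw (saw₁ s) s :=
  (contDiff_saw.differentiable (by norm_num) s).hasDerivAt

theorem hasDerivAt_saw₁ (s : ℝ) : HasDerivAt saw₁ (saw₂ s) s :=
  (contDiff_saw₁.differentiable (by norm_num) s).hasDerivAt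

theorem periodic_deriv {g : ℝ → ℝ} {c : ℝ} (h : Function.Periodic g c) :
    Function.Periodic (deriv g) c := fun x => by
  rw [← deriv_comp_add_const]
  congr 1
  funext y
  exact h y

theorem exists_bound_saw : ∃ B, ∀ s, |saw s| ≤ B ∧ |saw₁ s| ≤ B ∧ |saw₂ s| ≤ B := by
  obtain ⟨B₀, h₀⟩ := exists_bound_of_periodic contDiff_saw.continuous saw_periodic
  obtain ⟨B₁, h₁⟩ := exists_bound_of_periodic contDiff_saw₁.continuous
    (periodic_deriv saw_periodic)
  obtain ⟨B₂, h₂⟩ := exists_bound_of_periodic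
    (contDiff_saw₁.continuous_deriv le_rfl : Continuous saw₂)
    (periodic_deriv (periodic_deriv saw_periodic))
  exact ⟨max B₀ (max B₁ B₂), fun s => ⟨le_max_of_le_left (h₀ s),
    le_max_of_le_right (le_max_of_le_left (h₁ s)),
    le_max_of_le_right (le_max_of_le_right (h₂ s))⟩⟩

theorem saw_of_abs_le {x : ℝ} (hx : |x| ≤ Real.pi / 6) : saw x = -x := by
  obtain ⟨h1, h2⟩ := abs_le.1 hx
  have hpi := Real.pi_pos
  have h3 : Real.sin x ≤ 1 / 2 := by
    rw [← Real.sin_pi_div_six]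
    exact Real.sin_le_sin_of_le_of_le_pi_div_two (by linarith) (by linarith) h2
  have h4 : -(1 / 2) ≤ Real.sin x := by
    rw [← Real.sin_pi_div_six, ← Real.sin_neg]
    exact Real.sin_le_sin_of_le_of_le_pi_div_two (by linarith) (by linarith) h1
  rw [saw, Real.arcsin_sin (by linarith) (by linarith),
    Real.smoothTransition.one_of_one_le (by nlinarith), mul_one]

theorem saw_neg (x : ℝ) : saw (-x) = -saw x := by
  simp [saw]

theorem saw_mem_of_nonneg {x : ℝ} (h0 : 0 ≤ x) (hx : x ≤ Real.pi) : saw x ∈ Set.Icc (-x) 0 := by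
  have h1 : 0 ≤ Real.arcsin (Real.sin x) :=
    Real.arcsin_nonneg.2 (Real.sin_nonneg_of_nonneg_of_le_pi h0 hx)
  have h2 : Real.arcsin (Real.sin x) ≤ x := by
    rcases le_total x (Real.pi / 2) with h | h
    · rw [Real.arcsin_sin (by linarith) h]
    · exact (Real.arcsin_le_pi_div_two _).trans h
  have h3 := Real.smoothTransition.nonneg (2 - 4 * Real.sin x ^ 2)
  have h4 := Real.smoothTransition.le_one (2 - 4 * Real.sin x ^ 2)
  rw [saw]
  constructor <;> nlinarith

theorem saw₁_of_abs_lt {x : ℝ} (hx : |x| < Real.pi / 6) : saw₁ x = -1 := by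
  have : saw =ᶠ[nhds x] fun y => -y := by
    filter_upwards [(isOpen_lt continuous_abs continuous_const).mem_nhds hx] with y hy
      using saw_of_abs_le (le_of_lt hy)
  rw [saw₁, this.deriv_eq]
  simp

theorem saw₂_of_abs_lt {x : ℝ} (hx : |x| < Real.pi / 6) : saw₂ x = 0 := by
  have : saw₁ =ᶠ[nhds x] fun _ => -1 := by
    filter_upwards [(isOpen_lt continuous_abs continuous_const).mem_nhds hx] with y hy
      using saw₁_of_abs_lt hy
  rw [saw₂, this.deriv_eq]
  simp

/-- Away from the linear zone of the sawtooth, a phase `x + α saw x` stays away from `0` modulo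
`2π`. -/
theorem cos_add_saw_le {α x : ℝ} (h0 : 0 ≤ α) (h1 : α ≤ 1 / 2) (hx : Real.pi / 6 ≤ |x|)
    (hx' : |x| ≤ Real.pi) : Real.cos (x + α * saw x) ≤ Real.cos (Real.pi / 12) := by
  have key : ∀ y : ℝ, Real.pi / 6 ≤ y → y ≤ Real.pi →
      Real.cos (y + α * saw y) ≤ Real.cos (Real.pi / 12) := by
    intro y hy hy'
    have hpi := Real.pi_pos
    obtain ⟨a, b⟩ := saw_mem_of_nonneg (by linarith) hy'
    apply Real.cos_le_cos_of_nonneg_of_le_pi (by positivity) <;> nlinarith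
  rcases le_total 0 x with h | h
  · rw [abs_of_nonneg h] at hx hx'
    exact key x hx hx'
  · rw [abs_of_nonpos h] at hx hx'
    have := key (-x) hx hx'
    rw [saw_neg, ← Real.cos_neg] at this
    convert this using 2
    ring

/-! ### The modulated wave and its potential -/

theorem hasDerivAt_comp_const_mul {g : ℝ → ℝ} {g' k t : ℝ} (h : HasDerivAt g g' (k * t)) :
    HasDerivAt (fun s => g (k * s)) (k * g') t := by
  have := h.comp t ((hasDerivAt_id t).const_mul k)
  exact this.congr_deriv (by ring)

theorem contDiff_ofReal_comp {E : Type*} [NormedAddCommGroup E] [NormedSpace ℝ E] {g : E → ℝ}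
    (hg : ContDiff ℝ 2 g) : ContDiff ℝ 2 fun x => (g x : ℂ) :=
  Complex.ofRealCLM.contDiff.comp hg

theorem contDiff_re : ContDiff ℝ 2 Complex.re := Complex.reCLM.contDiff

theorem contDiff_im : ContDiff ℝ 2 Complex.im := Complex.imCLM.contDiff

/-- A smooth switch-off: `1` for `s ≤ 0` and `0` for `1 ≤ s`. -/
noncomputable def fade (s : ℝ) : ℝ := 1 - Real.smoothTransition s

theorem hasDerivAt_fade (s : ℝ) : HasDerivAt fade (-step₁ s) s := by
  exact (hasDerivAt_step s).const_sub 1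

theorem contDiff_fade : ContDiff ℝ 2 fade :=
  contDiff_const.sub Real.smoothTransition.contDiff

theorem fade_of_nonpos {s : ℝ} (hs : s ≤ 0) : fade s = 1 := by
  simp [fade, Real.smoothTransition.zero_of_nonpos hs]

theorem fade_of_one_le {s : ℝ} (hs : 1 ≤ s) : fade s = 0 := by
  simp [fade, Real.smoothTransition.one_of_one_le hs]

theorem abs_fade_le (s : ℝ) : |fade s| ≤ 1 := by
  have h1 := Real.smoothTransition.nonneg s
  have h2 := Real.smoothTransition.le_one s
  rw [fade, abs_le]
  constructor <;> linarith

/-- Minus the logarithm of the modulus of `wave`. -/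
noncomputable def waveDecay (n k t : ℝ) : ℝ := (n - k) * t + 2 * ramp (k * t)

/-- The argument of `wave`. -/
noncomputable def wavePhase (n k α t y : ℝ) : ℝ :=
  (n + k) * y + α * fade (k * t - 2) * saw ((2 * n + k) * y)

/-- The wave `exp (-h t + i F(t, y))` of mean angular frequency `n + k`. Its decay rate is `n - k`
while `k * t ≤ 2` and `n + k` from `k * t = 3` on; its phase carries a sawtooth modulation of
amplitude `α`, switched off between these two times. -/
noncomputable def wave (n k α t y : ℝ) : ℂ :=
  Complex.exp (-(waveDecay n k t : ℂ) + (wavePhase n k α t y : ℂ) * Complex.I)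

/-- The logarithmic derivative of `wave` in `t`. -/
noncomputable def waveLogT (n k α t y : ℝ) : ℂ :=
  -(((n - k) + 2 * (k * ramp₁ (k * t)) : ℝ) : ℂ)
    + ((α * (k * -step₁ (k * t - 2)) * saw ((2 * n + k) * y) : ℝ) : ℂ) * Complex.I

/-- The derivative of `waveLogT` in `t`. -/
noncomputable def waveLogTT (n k α t y : ℝ) : ℂ :=
  -((2 * (k * (k * ramp₂ (k * t))) : ℝ) : ℂ)
    + ((α * (k * -(k * step₂ (k * t - 2))) * saw ((2 * n + k) * y) : ℝ) : ℂ) * Complex.I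

/-- The logarithmic derivative of `wave` in `y`. -/
noncomputable def waveLogY (n k α t y : ℝ) : ℂ :=
  (((n + k) + α * fade (k * t - 2) * ((2 * n + k) * saw₁ ((2 * n + k) * y)) : ℝ) : ℂ) * Complex.I

/-- The derivative of `waveLogY` in `y`. -/
noncomputable def waveLogYY (n k α t y : ℝ) : ℂ :=
  ((α * fade (k * t - 2) * ((2 * n + k) * ((2 * n + k) * saw₂ ((2 * n + k) * y))) : ℝ) : ℂ)
    * Complex.I

/-- The quotient of the Laplacian of `wave` by `wave`. -/
noncomputable def wavePotential (n k α t y : ℝ) : ℂ :=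
  (waveLogTT n k α t y + waveLogT n k α t y ^ 2) + (waveLogYY n k α t y + waveLogY n k α t y ^ 2)

theorem hasDerivAt_comp_const_mul_sub {g : ℝ → ℝ} {g' k t c : ℝ} (h : HasDerivAt g g' (k * t - c)) :
    HasDerivAt (fun s => g (k * s - c)) (k * g') t :=
  hasDerivAt_comp_const_mul (g := fun s => g (s - c)) (h.comp_sub_const _ c)

theorem hasDerivAt_wave_t (n k α t y : ℝ) :
    HasDerivAt (fun s => wave n k α s y) (waveLogT n k α t y * wave n k α t y) t := by
  have h1 : HasDerivAt (fun s => waveDecay n k s) ((n - k) + 2 * (k * ramp₁ (k * t))) t := by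
    refine (((hasDerivAt_id t).const_mul (n - k)).add
      ((hasDerivAt_comp_const_mul (hasDerivAt_ramp (k * t))).const_mul 2)).congr_deriv ?_
    ring
  have h2 : HasDerivAt (fun s => wavePhase n k α s y)
      (α * (k * -step₁ (k * t - 2)) * saw ((2 * n + k) * y)) t :=
    (((hasDerivAt_comp_const_mul_sub (hasDerivAt_fade (k * t - 2))).const_mul α).mul_const
      (saw ((2 * n + k) * y))).const_add ((n + k) * y)
  have h := (h1.ofReal_comp.neg.add (h2.ofReal_comp.mul_const Complex.I)).cexp
  exact h.congr_deriv (mul_comm _ _)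

theorem hasDerivAt_waveLogT (n k α t y : ℝ) :
    HasDerivAt (fun s => waveLogT n k α s y) (waveLogTT n k α t y) t := by
  have h1 : HasDerivAt (fun s => (n - k) + 2 * (k * ramp₁ (k * s)))
      (2 * (k * (k * ramp₂ (k * t)))) t :=
    (((hasDerivAt_comp_const_mul (hasDerivAt_ramp₁ (k * t))).const_mul k).const_mul 2).const_add _
  have h2 : HasDerivAt (fun s => α * (k * -step₁ (k * s - 2)) * saw ((2 * n + k) * y))
      (α * (k * -(k * step₂ (k * t - 2))) * saw ((2 * n + k) * y)) t :=
    (((hasDerivAt_comp_const_mul_sub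
      (hasDerivAt_step₁ (k * t - 2))).neg.const_mul k).const_mul α).mul_const _
  exact h1.ofReal_comp.neg.add (h2.ofReal_comp.mul_const Complex.I)

theorem hasDerivAt_wave_y (n k α t y : ℝ) :
    HasDerivAt (fun s => wave n k α t s) (waveLogY n k α t y * wave n k α t y) y := by
  have h2 : HasDerivAt (fun s => wavePhase n k α t s)
      ((n + k) + α * fade (k * t - 2) * ((2 * n + k) * saw₁ ((2 * n + k) * y))) y := by
    refine (((hasDerivAt_id y).const_mul (n + k)).add
      ((hasDerivAt_comp_const_mul (hasDerivAt_saw ((2 * n + k) * y))).const_mul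
        (α * fade (k * t - 2)))).congr_deriv ?_
    ring
  have h := ((h2.ofReal_comp.mul_const Complex.I).const_add (-(waveDecay n k t : ℂ))).cexp
  exact h.congr_deriv (mul_comm _ _)

theorem hasDerivAt_waveLogY (n k α t y : ℝ) :
    HasDerivAt (fun s => waveLogY n k α t s) (waveLogYY n k α t y) y := by
  have h2 : HasDerivAt
      (fun s => (n + k) + α * fade (k * t - 2) * ((2 * n + k) * saw₁ ((2 * n + k) * s)))
      (α * fade (k * t - 2) * ((2 * n + k) * ((2 * n + k) * saw₂ ((2 * n + k) * y)))) y :=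
    (((hasDerivAt_comp_const_mul (hasDerivAt_saw₁ ((2 * n + k) * y))).const_mul
      (2 * n + k)).const_mul _).const_add _
  exact h2.ofReal_comp.mul_const Complex.I

theorem contDiff_wave (n k α : ℝ) : ContDiff ℝ 2 fun w : ℂ => wave n k α w.re w.im := by
  have hr := contDiff_re
  have hi := contDiff_im
  have h1 : ContDiff ℝ 2 fun w : ℂ => waveDecay n k w.re :=
    (contDiff_const.mul hr).add (contDiff_const.mul (contDiff_ramp.comp (contDiff_const.mul hr)))
  have h2 : ContDiff ℝ 2 fun w : ℂ => wavePhase n k α w.re w.im :=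
    (contDiff_const.mul hi).add ((contDiff_const.mul
      (contDiff_fade.comp ((contDiff_const.mul hr).sub contDiff_const))).mul
      (contDiff_saw.comp (contDiff_const.mul hi)))
  exact ((contDiff_ofReal_comp h1).neg.add ((contDiff_ofReal_comp h2).mul contDiff_const)).cexp

/-- A number `B ≥ 1` that bounds the profiles of the construction together with their
derivatives. -/
def IsProfileBound (B : ℝ) : Prop :=
  1 ≤ B ∧ (∀ s, |step₁ s| ≤ B ∧ |step₂ s| ≤ B) ∧ (∀ s, |ramp₁ s| ≤ B ∧ |ramp₂ s| ≤ B) ∧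
    ∀ s, |saw s| ≤ B ∧ |saw₁ s| ≤ B ∧ |saw₂ s| ≤ B

theorem exists_isProfileBound : ∃ B, IsProfileBound B := by
  obtain ⟨a, ha⟩ := exists_bound_step
  obtain ⟨b, hb⟩ := exists_bound_ramp
  obtain ⟨c, hc⟩ := exists_bound_saw
  have h1 : a ≤ max 1 (max a (max b c)) := by simp
  have h2 : b ≤ max 1 (max a (max b c)) := by simp
  have h3 : c ≤ max 1 (max a (max b c)) := by simp
  exact ⟨max 1 (max a (max b c)), le_max_left _ _,
    fun s => ⟨(ha s).1.trans h1, (ha s).2.trans h1⟩,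
    fun s => ⟨(hb s).1.trans h2, (hb s).2.trans h2⟩,
    fun s => ⟨(hc s).1.trans h3, (hc s).2.1.trans h3, (hc s).2.2.trans h3⟩⟩

theorem abs_mul_le_of_le {a b A B : ℝ} (ha : |a| ≤ A) (hb : |b| ≤ B) : |a * b| ≤ A * B := by
  rw [abs_mul]
  exact mul_le_mul ha hb (abs_nonneg _) ((abs_nonneg _).trans ha)

theorem norm_ofReal_add_ofReal_mul_I_le (a b : ℝ) : ‖(a : ℂ) + b * Complex.I‖ ≤ |a| + |b| := by
  refine (norm_add_le _ _).trans ?_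
  simp

theorem norm_waveLogT_le {B n k α : ℝ} (hB : IsProfileBound B) (hn : 0 ≤ n) (hk : 0 ≤ k)
    (hα : 0 ≤ α) (hαk : α * (2 * n + k) ≤ 2 * k) (t y : ℝ) :
    ‖waveLogT n k α t y‖ ≤ 5 * B ^ 2 * (2 * n + k) := by
  obtain ⟨h1, hs, hr, hw⟩ := hB
  have hq : α * k ≤ 2 * k := le_trans (mul_le_mul_of_nonneg_left (by linarith) hα) hαk
  have e := norm_ofReal_add_ofReal_mul_I_le (-((n - k) + 2 * (k * ramp₁ (k * t))))
    (α * (k * -step₁ (k * t - 2)) * saw ((2 * n + k) * y))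
  rw [Complex.ofReal_neg] at e
  refine e.trans ?_
  have b1 : |-((n - k) + 2 * (k * ramp₁ (k * t)))| ≤ (2 * n + k) + 2 * (k * B) := by
    rw [abs_neg]
    refine (abs_add_le _ _).trans (add_le_add ?_ ?_)
    · rw [abs_le]; constructor <;> linarith
    · rw [abs_mul, abs_mul, abs_two, abs_of_nonneg hk]
      have := (hr (k * t)).1
      gcongr
  have b2 : |α * (k * -step₁ (k * t - 2)) * saw ((2 * n + k) * y)| ≤ 2 * k * B * B := by
    have : α * (k * -step₁ (k * t - 2)) = (α * k) * -step₁ (k * t - 2) := by ring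
    rw [this]
    refine abs_mul_le_of_le (abs_mul_le_of_le ?_ ?_) (hw _).1
    · rw [abs_of_nonneg (by positivity)]; exact hq
    · rw [abs_neg]; exact (hs _).1
  have b3 : k * B ≤ (2 * n + k) * B ^ 2 := by
    have : B ≤ B ^ 2 := by nlinarith
    exact mul_le_mul (by linarith) this (by linarith) (by linarith)
  have b4 : k * B ^ 2 ≤ (2 * n + k) * B ^ 2 :=
    mul_le_mul_of_nonneg_right (by linarith) (by positivity)
  have b5 : (2 * n + k) ≤ (2 * n + k) * B ^ 2 :=
    le_mul_of_one_le_right (by linarith) (by nlinarith)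
  nlinarith

/-- The potential of `wave` has size the product of the frequency and of its increment: all the
squares of the frequency cancel. -/
theorem norm_wavePotential_le {B n k α : ℝ} (hB : IsProfileBound B) (hn : 0 ≤ n) (hk : 0 ≤ k)
    (hα : 0 ≤ α) (hαk : α * (2 * n + k) ≤ 2 * k) (t y : ℝ) :
    ‖wavePotential n k α t y‖ ≤ 42 * B ^ 4 * ((2 * n + k) * k) := by
  obtain ⟨h1, hs, hr, hw⟩ := hB
  have hq : α * k ≤ 2 * k := le_trans (mul_le_mul_of_nonneg_left (by linarith) hα) hαk
  set P := 2 * n + k with hP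
  have hkP : k ≤ P := by linarith
  have hP0 : 0 ≤ P := by linarith
  set r₁ := ramp₁ (k * t)
  set r₂ := ramp₂ (k * t)
  set s₁ := step₁ (k * t - 2)
  set s₂ := step₂ (k * t - 2)
  set f := fade (k * t - 2)
  set w := saw (P * y)
  set w₁ := saw₁ (P * y)
  set w₂ := saw₂ (P * y)
  have hr₁ : |r₁| ≤ B := (hr _).1
  have hr₂ : |r₂| ≤ B := (hr _).2
  have hs₁ : |-s₁| ≤ B := by rw [abs_neg]; exact (hs _).1
  have hs₂ : |-s₂| ≤ B := by rw [abs_neg]; exact (hs _).2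
  have hf : |f| ≤ 1 := abs_fade_le _
  have hw₀ : |w| ≤ B := (hw _).1
  have hw₁ : |w₁| ≤ B := (hw _).2.1
  have hw₂ : |w₂| ≤ B := (hw _).2.2
  have hαk' : |α * k| ≤ 2 * k := by rwa [abs_of_nonneg (by positivity)]
  have hαP' : |α * P| ≤ 2 * k := by rwa [abs_of_nonneg (by positivity)]
  have hk' : |k| ≤ k := (abs_of_nonneg hk).le
  have hP' : |P| ≤ P := (abs_of_nonneg hP0).le
  -- the slope of the decay, the modulation of the frequency and the drift of the phase
  set a := (n - k) + 2 * (k * r₁) with ha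
  set e := α * f * (P * w₁) with he
  set q := α * (k * -s₁) * w with hq'
  -- `a ^ 2 - (n + k) ^ 2` is written as a product with a factor of order `k`
  have key : wavePotential n k α t y
      = ((-(2 * (k * k * r₂)) + (2 * k * (r₁ - 1)) * (2 * n + 2 * k * r₁) - q * q
          - e * (2 * (n + k) + e) : ℝ) : ℂ)
        + ((α * k * k * (-s₂) * w + α * P * P * f * w₂ - 2 * a * q : ℝ) : ℂ) * Complex.I := by
    have e1 : waveLogTT n k α t y = -((2 * (k * (k * r₂)) : ℝ) : ℂ)
        + ((α * (k * -(k * s₂)) * w : ℝ) : ℂ) * Complex.I := rfl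
    have e2 : waveLogT n k α t y = -(a : ℂ) + (q : ℂ) * Complex.I := rfl
    have e3 : waveLogYY n k α t y = ((α * f * (P * (P * w₂)) : ℝ) : ℂ) * Complex.I := rfl
    have e4 : waveLogY n k α t y = (((n + k) + e : ℝ) : ℂ) * Complex.I := rfl
    rw [wavePotential, e1, e2, e3, e4, ha]
    push_cast
    linear_combination (((n : ℂ) + k + e) ^ 2 + (q : ℂ) ^ 2) * Complex.I_sq
  have be : |e| ≤ 2 * k * B := by
    have : e = α * P * f * w₁ := by rw [he]; ring
    rw [this]
    simpa using abs_mul_le_of_le (abs_mul_le_of_le hαP' hf) hw₁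
  have bq : |q| ≤ 2 * k * B * B := by
    have : q = α * k * -s₁ * w := by rw [hq']; ring
    rw [this]
    exact abs_mul_le_of_le (abs_mul_le_of_le hαk' hs₁) hw₀
  have hPB : P ≤ P * B := le_mul_of_one_le_right hP0 h1
  have hkB : k * B ≤ P * B := mul_le_mul_of_nonneg_right hkP (by linarith)
  have bkr : |k * r₁| ≤ k * B := abs_mul_le_of_le hk' hr₁
  have ba : |a| ≤ 3 * (P * B) := by
    have := abs_le.1 bkr
    rw [ha, abs_le]
    constructor <;> linarith
  have t1 : |2 * (k * k * r₂)| ≤ 2 * (k * k * B) := by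
    rw [abs_mul, abs_two]
    linarith [abs_mul_le_of_le (abs_mul_le_of_le hk' hk') hr₂]
  have t2 : |(2 * k * (r₁ - 1)) * (2 * n + 2 * k * r₁)| ≤ (2 * k * (2 * B)) * (3 * (P * B)) := by
    refine abs_mul_le_of_le (abs_mul_le_of_le ?_ ?_) ?_
    · rw [abs_of_nonneg (by linarith)]
    · have := abs_le.1 hr₁
      rw [abs_le]; constructor <;> linarith
    · have := abs_le.1 bkr
      rw [abs_le]; constructor <;> linarith
  have t3 : |q * q| ≤ (2 * k * B * B) * (2 * k * B * B) := abs_mul_le_of_le bq bq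
  have t4 : |e * (2 * (n + k) + e)| ≤ (2 * k * B) * (4 * (P * B)) := by
    refine abs_mul_le_of_le be ?_
    have := abs_le.1 be
    rw [abs_le]; constructor <;> linarith
  have t5 : |α * k * k * (-s₂) * w| ≤ 2 * k * k * B * B :=
    abs_mul_le_of_le (abs_mul_le_of_le (abs_mul_le_of_le hαk' hk') hs₂) hw₀
  have t6 : |α * P * P * f * w₂| ≤ 2 * k * P * 1 * B :=
    abs_mul_le_of_le (abs_mul_le_of_le (abs_mul_le_of_le hαP' hP') hf) hw₂
  have t7 : |2 * a * q| ≤ 2 * (3 * (P * B)) * (2 * k * B * B) := by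
    refine abs_mul_le_of_le ?_ bq
    rw [abs_mul, abs_two]
    linarith
  rw [key]
  refine (norm_ofReal_add_ofReal_mul_I_le _ _).trans ?_
  have s1 : |-(2 * (k * k * r₂)) + (2 * k * (r₁ - 1)) * (2 * n + 2 * k * r₁) - q * q
          - e * (2 * (n + k) + e)| ≤ 2 * (k * k * B) + (2 * k * (2 * B)) * (3 * (P * B))
          + (2 * k * B * B) * (2 * k * B * B) + (2 * k * B) * (4 * (P * B)) := by
    rw [abs_le] at *
    constructor <;> linarith
  have s2 : |α * k * k * (-s₂) * w + α * P * P * f * w₂ - 2 * a * q| ≤ 2 * k * k * B * B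
      + 2 * k * P * 1 * B + 2 * (3 * (P * B)) * (2 * k * B * B) := by
    rw [abs_le] at *
    constructor <;> linarith
  have hkk : k * k ≤ P * k := mul_le_mul_of_nonneg_right hkP hk
  have pw : ∀ {x : ℝ} (m : ℕ), m ≤ 4 → 0 ≤ x → x ≤ P * k → x * B ^ m ≤ P * k * B ^ 4 := by
    intro x m hm hx hxk
    exact mul_le_mul hxk (pow_le_pow_right₀ h1 hm) (by positivity) (by positivity)
  have hPk : 0 ≤ P * k := by positivity
  have hkk0 : 0 ≤ k * k := by positivity
  have u1 := pw 1 (by norm_num) hkk0 hkk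
  have u2 := pw 2 (by norm_num) hPk le_rfl
  have u3 := pw 4 (by norm_num) hkk0 hkk
  have u5 := pw 2 (by norm_num) hkk0 hkk
  have u6 := pw 1 (by norm_num) hPk le_rfl
  have u7 := pw 3 (by norm_num) hPk le_rfl
  linarith

/-! ### Transitions between two waves -/

theorem laplacian_wave (n k α : ℝ) (w : ℂ) :
    Laplacian.laplacian (fun w : ℂ => wave n k α w.re w.im) w
      = wavePotential n k α w.re w.im * wave n k α w.re w.im := by
  rw [laplacian_eq_of_partials (contDiff_wave n k α) (hasDerivAt_wave_t n k α)
    (fun t y => (hasDerivAt_waveLogT n k α t y).mul (hasDerivAt_wave_t n k α t y))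
    (hasDerivAt_wave_y n k α)
    (fun t y => (hasDerivAt_waveLogY n k α t y).mul (hasDerivAt_wave_y n k α t y)),
    wavePotential]
  ring

theorem wave_periodic (n k : ℕ) (α : ℝ) :
    Function.Periodic (fun w : ℂ => wave n k α w.re w.im) (2 * Real.pi * Complex.I) := by
  intro w
  have e : (w + 2 * Real.pi * Complex.I).im = w.im + 2 * Real.pi := by simp
  have e' : (w + 2 * Real.pi * Complex.I).re = w.re := by simp
  have hs : saw ((2 * n + k) * (w.im + 2 * Real.pi)) = saw ((2 * n + k) * w.im) := by
    have := (saw_periodic.nat_mul (2 * n + k)) ((2 * n + k) * w.im)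
    rw [← this]
    congr 1
    push_cast
    ring
  have hφ : wavePhase n k α w.re (w.im + 2 * Real.pi)
      = wavePhase n k α w.re w.im + (n + k : ℕ) * (2 * Real.pi) := by
    rw [wavePhase, wavePhase, hs]
    push_cast
    ring
  simp only [e, e', wave, hφ]
  rw [Complex.exp_eq_exp_iff_exists_int]
  refine ⟨(n + k : ℕ), ?_⟩
  push_cast
  ring

/-- Beyond `k * t = 3` the wave is antiholomorphic, hence harmonic. -/
theorem wave_of_ge {n k α : ℝ} {w : ℂ} (h : 3 ≤ k * w.re) :
    wave n k α w.re w.im = Complex.exp (-((n + k : ℝ) : ℂ) * (starRingEnd ℂ) w) := by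
  rw [wave, waveDecay, wavePhase, ramp_of_ge h, fade_of_one_le (by linarith)]
  congr 1
  apply Complex.ext
  · simp
    ring
  · simp
    ring

/-- The transition, at frequency `m`, from `exp (m w)` to `exp (-m w̄)`. -/
theorem exists_flip : ∃ A : ℝ, 0 < A ∧ ∀ m : ℕ, ∃ s : ℂ → ℂ, ContDiff ℝ 2 s ∧
    Function.Periodic s (2 * Real.pi * Complex.I) ∧
    (∀ w : ℂ, m * w.re ≤ 2 → s w = Complex.exp (m * w)) ∧
    (∀ w : ℂ, 3 ≤ m * w.re → s w = Complex.exp (-m * (starRingEnd ℂ) w)) ∧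
    ∀ w, ‖Laplacian.laplacian s w‖ ≤ A * m ^ 2 * ‖s w‖ := by
  obtain ⟨B, hB⟩ := exists_isProfileBound
  have hB0 : 0 < B := by linarith [hB.1]
  refine ⟨42 * B ^ 4, by positivity, fun m => ⟨fun w => wave (0 : ℕ) m 0 w.re w.im,
    contDiff_wave _ _ _, wave_periodic 0 m 0, fun w hw => ?_, fun w hw => ?_, fun w => ?_⟩⟩
  · simp only [wave, waveDecay, wavePhase, ramp_of_le hw]
    congr 1
    apply Complex.ext <;> simp
  · simp only [wave_of_ge hw]
    simp
  · rw [laplacian_wave, norm_mul]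
    have := norm_wavePotential_le (n := ((0 : ℕ) : ℝ)) (k := m) (α := 0) hB (by simp) (by simp)
      le_rfl (by simp) w.re w.im
    refine mul_le_mul_of_nonneg_right (this.trans (le_of_eq ?_)) (norm_nonneg _)
    push_cast
    ring

/-- A complex number of modulus `r` whose argument is away from `0` is far from `1`. -/
theorem mul_le_norm_one_sub {r c ψ : ℝ} (hr : 0 ≤ r) (hc : 0 ≤ c) (hψ : Real.cos ψ ≤ c) :
    Real.sqrt (1 - c) * r ≤ ‖1 - (r : ℂ) * Complex.exp (ψ * Complex.I)‖ := by
  rcases le_total (1 - c) 0 with h | h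
  · rw [Real.sqrt_eq_zero_of_nonpos h, zero_mul]
    exact norm_nonneg _
  rw [← abs_of_nonneg (norm_nonneg (1 - (r : ℂ) * Complex.exp (ψ * Complex.I))),
    ← abs_of_nonneg (mul_nonneg (Real.sqrt_nonneg (1 - c)) hr), ← sq_le_sq, mul_pow,
    Real.sq_sqrt h, Complex.sq_norm, Complex.normSq_apply]
  simp only [Complex.sub_re, Complex.sub_im, Complex.one_re, Complex.one_im, Complex.re_ofReal_mul,
    Complex.im_ofReal_mul, Complex.exp_ofReal_mul_I_re, Complex.exp_ofReal_mul_I_im]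
  have h1 := Real.sin_sq_add_cos_sq ψ
  have h2 : r * Real.cos ψ ≤ r * c := mul_le_mul_of_nonneg_left hψ hr
  nlinarith [mul_nonneg hc (sq_nonneg (1 - r)), mul_nonneg h (sq_nonneg r)]

/-- The harmonic function `exp (-n w)` in Cartesian coordinates. -/
noncomputable def holWave (n t y : ℝ) : ℂ := Complex.exp (-(n : ℂ) * (t + y * Complex.I))

theorem hasDerivAt_holWave_t (n t y : ℝ) :
    HasDerivAt (fun s => holWave n s y) (-(n : ℂ) * holWave n t y) t := by
  have h := (((Complex.ofRealCLM.hasDerivAt (x := t)).add_const ((y : ℂ) * Complex.I)).const_mul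
    (-(n : ℂ))).cexp
  refine h.congr_deriv ?_
  simp [holWave, mul_comm]

theorem hasDerivAt_holWave_y (n t y : ℝ) :
    HasDerivAt (fun s => holWave n t s) (-(n : ℂ) * Complex.I * holWave n t y) y := by
  have h := ((((Complex.ofRealCLM.hasDerivAt (x := y)).mul_const Complex.I).const_add
    (t : ℂ)).const_mul (-(n : ℂ))).cexp
  refine h.congr_deriv ?_
  simp [holWave, mul_comm]

theorem contDiff_holWave (n : ℝ) : ContDiff ℝ 2 fun w : ℂ => holWave n w.re w.im :=
  (contDiff_const.mul ((contDiff_ofReal_comp contDiff_re).add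
    ((contDiff_ofReal_comp contDiff_im).mul contDiff_const))).cexp

/-- Before `k * t = 2`, the ratio of the two waves has modulus `exp (k t)`, and its argument is the
sawtooth phase. -/
theorem wave_eq_holWave_mul {n k α t y : ℝ} (h : k * t ≤ 2) :
    wave n k α t y = holWave n t y * ((Real.exp (k * t) : ℂ)
      * Complex.exp (((2 * n + k) * y + α * saw ((2 * n + k) * y) : ℝ) * Complex.I)) := by
  rw [wave, waveDecay, wavePhase, ramp_of_le h, fade_of_nonpos (by linarith), holWave,
    Complex.ofReal_exp, ← Complex.exp_add, ← Complex.exp_add]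
  congr 1
  push_cast
  ring

/-- The transition from `exp (-n w)` to an antiholomorphic wave of frequency `n + k`. -/
noncomputable def stepWave (n k α t y : ℝ) : ℂ :=
  (fade (k * t - 1) : ℂ) * holWave n t y
    - (Real.smoothTransition (k * t - -2) : ℂ) * wave n k α t y

theorem contDiff_stepWave (n k α : ℝ) : ContDiff ℝ 2 fun w : ℂ => stepWave n k α w.re w.im :=
  ((contDiff_ofReal_comp (contDiff_fade.comp ((contDiff_const.mul contDiff_re).sub
    contDiff_const))).mul (contDiff_holWave n)).sub
  ((contDiff_ofReal_comp (Real.smoothTransition.contDiff.comp ((contDiff_const.mul contDiff_re).sub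
    contDiff_const))).mul (contDiff_wave n k α))

theorem laplacian_stepWave (n k α : ℝ) (w : ℂ) :
    Laplacian.laplacian (fun w : ℂ => stepWave n k α w.re w.im) w
      = (-(k * k * step₂ (k * w.re - 1) : ℝ) + 2 * (k * step₁ (k * w.re - 1) : ℝ) * n)
          * holWave n w.re w.im
        - ((k * k * step₂ (k * w.re - -2) : ℝ)
            + 2 * (k * step₁ (k * w.re - -2) : ℝ) * waveLogT n k α w.re w.im
            + (Real.smoothTransition (k * w.re - -2) : ℝ) * wavePotential n k α w.re w.im)
          * wave n k α w.re w.im := by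
  have c1 : ∀ t, HasDerivAt (fun s : ℝ => (fade (k * s - 1) : ℂ))
      ((k * -step₁ (k * t - 1) : ℝ) : ℂ) t := fun t =>
    (hasDerivAt_comp_const_mul_sub (hasDerivAt_fade _)).ofReal_comp
  have c2 : ∀ t, HasDerivAt (fun s : ℝ => ((k * -step₁ (k * s - 1) : ℝ) : ℂ))
      ((k * -(k * step₂ (k * t - 1)) : ℝ) : ℂ) t := fun t =>
    ((hasDerivAt_comp_const_mul_sub (hasDerivAt_step₁ _)).neg.const_mul k).ofReal_comp
  have d1 : ∀ t, HasDerivAt (fun s : ℝ => (Real.smoothTransition (k * s - -2) : ℂ))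
      ((k * step₁ (k * t - -2) : ℝ) : ℂ) t := fun t =>
    (hasDerivAt_comp_const_mul_sub (hasDerivAt_step _)).ofReal_comp
  have d2 : ∀ t, HasDerivAt (fun s : ℝ => ((k * step₁ (k * s - -2) : ℝ) : ℂ))
      ((k * (k * step₂ (k * t - -2)) : ℝ) : ℂ) t := fun t =>
    ((hasDerivAt_comp_const_mul_sub (hasDerivAt_step₁ _)).const_mul k).ofReal_comp
  have E1 := fun t y => hasDerivAt_holWave_t n t y
  have W1 := fun t y => hasDerivAt_wave_t n k α t y
  have W2 := fun t y => (hasDerivAt_waveLogT n k α t y).mul (W1 t y)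
  have E3 := fun t y => hasDerivAt_holWave_y n t y
  have W3 := fun t y => hasDerivAt_wave_y n k α t y
  have W4 := fun t y => (hasDerivAt_waveLogY n k α t y).mul (W3 t y)
  rw [laplacian_eq_of_partials (contDiff_stepWave n k α)
    (fun t y => ((c1 t).mul (E1 t y)).sub ((d1 t).mul (W1 t y)))
    (fun t y => (((c2 t).mul (E1 t y)).add ((c1 t).mul ((E1 t y).const_mul (-(n : ℂ))))).sub
      (((d2 t).mul (W1 t y)).add ((d1 t).mul (W2 t y))))
    (fun t y => ((E3 t y).const_mul _).sub ((W3 t y).const_mul _))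
    (fun t y => (((E3 t y).const_mul (-(n : ℂ) * Complex.I)).const_mul _).sub
      ((W4 t y).const_mul _)), wavePotential]
  push_cast
  linear_combination (fade (k * w.re - 1) * (n : ℂ) ^ 2 * holWave n w.re w.im) * Complex.I_sq

/-! ### Size of the potential of a transition -/

/-- Where the sawtooth is linear, its slope lowers the frequency from `n + k` to `n - k`, so that
`wave` is antiholomorphic. -/
theorem wavePotential_eq_zero {n k α t y : ℝ} (hα : α * (2 * n + k) = 2 * k) (ht : k * t < 2)
    (h₁ : saw₁ ((2 * n + k) * y) = -1) (h₂ : saw₂ ((2 * n + k) * y) = 0) :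
    wavePotential n k α t y = 0 := by
  rw [wavePotential, waveLogTT, waveLogT, waveLogYY, waveLogY, h₁, h₂, ramp₁_of_lt ht,
    ramp₂_of_lt ht, step₁_of_neg (by linarith), step₂_of_neg (by linarith),
    fade_of_nonpos (by linarith)]
  have e : n + k + α * 1 * ((2 * n + k) * -1) = n - k := by linear_combination -hα
  rw [e]
  push_cast
  linear_combination ((n : ℂ) - k) ^ 2 * Complex.I_sq

theorem exists_abs_le_pi_of_mod (x : ℝ) :
    ∃ x' : ℝ, |x'| ≤ Real.pi ∧ ∃ m : ℤ, x = x' + m * (2 * Real.pi) := by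
  refine ⟨toIocMod Real.two_pi_pos (-Real.pi) x, ?_, toIocDiv Real.two_pi_pos (-Real.pi) x, ?_⟩
  · have := toIocMod_mem_Ioc Real.two_pi_pos (-Real.pi) x
    rw [abs_le]
    constructor <;> linarith [this.1, this.2]
  · rw [← zsmul_eq_mul, toIocMod_add_toIocDiv_zsmul]

/-- At every phase, either `x` lies in the linear zone of the sawtooth, or `x + α saw x` is away
from `0` modulo `2π`. -/
theorem saw_zone_or_cos_le {α : ℝ} (h0 : 0 ≤ α) (h1 : α ≤ 1 / 2) (x : ℝ) :
    (saw₁ x = -1 ∧ saw₂ x = 0) ∨ Real.cos (x + α * saw x) ≤ Real.cos (Real.pi / 12) := by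
  obtain ⟨x', hx', m, rfl⟩ := exists_abs_le_pi_of_mod x
  have e0 : saw (x' + m * (2 * Real.pi)) = saw x' := saw_periodic.int_mul m x'
  have e1 : saw₁ (x' + m * (2 * Real.pi)) = saw₁ x' := (periodic_deriv saw_periodic).int_mul m x'
  have e2 : saw₂ (x' + m * (2 * Real.pi)) = saw₂ x' :=
    (periodic_deriv (periodic_deriv saw_periodic)).int_mul m x'
  rcases lt_or_ge |x'| (Real.pi / 6) with h | h
  · left
    rw [e1, e2]
    exact ⟨saw₁_of_abs_lt h, saw₂_of_abs_lt h⟩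
  · right
    rw [e0, add_right_comm, Real.cos_add_int_mul_two_pi]
    exact cos_add_saw_le h0 h1 h hx'

theorem sqrt_one_sub_cos_pos : 0 < Real.sqrt (1 - Real.cos (Real.pi / 12)) := by
  rw [Real.sqrt_pos, sub_pos, ← Real.cos_zero]
  have := Real.pi_pos
  exact Real.cos_lt_cos_of_nonneg_of_le_pi le_rfl (by linarith) (by linarith)

/-- The potential of the transition. Where the two waves have comparable size, either both are
harmonic or they do not cancel. -/
theorem norm_laplacian_stepWave_le {B n k α : ℝ} (hB : IsProfileBound B) (hn : 0 ≤ n) (hk : 0 ≤ k)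
    (hα : α * (2 * n + k) = 2 * k) (h0 : 0 ≤ α) (h1 : α ≤ 1 / 2) (w : ℂ) :
    ‖Laplacian.laplacian (fun w : ℂ => stepWave n k α w.re w.im) w‖
      ≤ 53 * B ^ 4 * (3 + 1 / Real.sqrt (1 - Real.cos (Real.pi / 12))) * ((2 * n + k) * k)
        * ‖stepWave n k α w.re w.im‖ := by
  rw [laplacian_stepWave]
  have hP := norm_wavePotential_le hB hn hk h0 hα.le w.re w.im
  have hL := norm_waveLogT_le hB hn hk h0 hα.le w.re w.im
  have hB1 := hB.1
  have hstep := hB.2.1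
  have hc := sqrt_one_sub_cos_pos
  set c := Real.sqrt (1 - Real.cos (Real.pi / 12)) with hc'
  set t := w.re
  set y := w.im
  set V := wavePotential n k α t y with hV
  set E := holWave n t y with hE
  set W := wave n k α t y with hW
  set X := (-(k * k * step₂ (k * t - 1) : ℝ) : ℂ) + 2 * (k * step₁ (k * t - 1) : ℝ) * n with hX
  set Y := ((k * k * step₂ (k * t - -2) : ℝ) : ℂ)
            + 2 * (k * step₁ (k * t - -2) : ℝ) * waveLogT n k α t y
            + (Real.smoothTransition (k * t - -2) : ℝ) * V with hY
  set D := 53 * B ^ 4 * ((2 * n + k) * k) with hD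
  have hPk : 0 ≤ (2 * n + k) * k := by positivity
  have hD0 : 0 ≤ D := by positivity
  have hkk : k * k ≤ (2 * n + k) * k := by nlinarith
  have hB4 : B ≤ B ^ 4 := le_self_pow₀ hB1 (by norm_num)
  have hB34 : B ^ 3 ≤ B ^ 4 := pow_le_pow_right₀ hB1 (by norm_num)
  have hkkB : k * k * B ≤ B ^ 4 * ((2 * n + k) * k) := by
    rw [mul_comm]
    exact mul_le_mul hB4 hkk (by positivity) (by positivity)
  have bX : ‖X‖ ≤ D := by
    have b1 : ‖(-(k * k * step₂ (k * t - 1) : ℝ) : ℂ)‖ ≤ k * k * B := by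
      rw [norm_neg, Complex.norm_real, Real.norm_eq_abs, abs_mul, abs_of_nonneg (by positivity)]
      exact mul_le_mul_of_nonneg_left (hstep _).2 (by positivity)
    have b2 : ‖(2 : ℂ) * (k * step₁ (k * t - 1) : ℝ) * n‖ ≤ 2 * (k * B) * n := by
      rw [norm_mul, norm_mul, Complex.norm_real, Complex.norm_real, Complex.norm_two,
        Real.norm_eq_abs, Real.norm_eq_abs, abs_mul, abs_of_nonneg hk, abs_of_nonneg hn]
      have := (hstep (k * t - 1)).1
      gcongr
    have b3 : 2 * (k * B) * n ≤ B ^ 4 * ((2 * n + k) * k) := by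
      have : B * (2 * n * k) ≤ B ^ 4 * ((2 * n + k) * k) :=
        mul_le_mul hB4 (by nlinarith) (by positivity) (by positivity)
      linarith
    have b4 : 0 ≤ B ^ 4 * ((2 * n + k) * k) := by positivity
    refine (norm_add_le _ _).trans ?_
    rw [hD]
    linarith
  have bV : ‖V‖ ≤ D := by
    have b4 : 0 ≤ B ^ 4 * ((2 * n + k) * k) := by positivity
    rw [hD]
    linarith
  have bY : ‖Y‖ ≤ D := by
    have b1 : ‖((k * k * step₂ (k * t - -2) : ℝ) : ℂ)‖ ≤ k * k * B := by
      rw [Complex.norm_real, Real.norm_eq_abs, abs_mul, abs_of_nonneg (by positivity)]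
      exact mul_le_mul_of_nonneg_left (hstep _).2 (by positivity)
    have b2 : ‖(2 : ℂ) * (k * step₁ (k * t - -2) : ℝ) * waveLogT n k α t y‖
        ≤ 2 * (k * B) * (5 * B ^ 2 * (2 * n + k)) := by
      rw [norm_mul, norm_mul, Complex.norm_real, Complex.norm_two, Real.norm_eq_abs, abs_mul,
        abs_of_nonneg hk]
      have := (hstep (k * t - -2)).1
      gcongr
    have b3 : 2 * (k * B) * (5 * B ^ 2 * (2 * n + k)) ≤ 10 * (B ^ 4 * ((2 * n + k) * k)) := by
      have := mul_le_mul_of_nonneg_right hB34 hPk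
      linarith
    have b5 : ‖((Real.smoothTransition (k * t - -2) : ℝ) : ℂ) * V‖ ≤ ‖V‖ := by
      rw [norm_mul, Complex.norm_real, Real.norm_eq_abs,
        abs_of_nonneg (Real.smoothTransition.nonneg _)]
      exact mul_le_of_le_one_left (norm_nonneg _) (Real.smoothTransition.le_one _)
    refine (norm_add_le _ _).trans ((add_le_add (norm_add_le _ _) le_rfl).trans ?_)
    rw [hD]
    linarith
  have hgoal : 53 * B ^ 4 * (3 + 1 / c) * ((2 * n + k) * k) = 3 * D + D / c := by
    rw [hD]; ring
  have hDc : 0 ≤ D / c := div_nonneg hD0 hc.le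
  rw [hgoal]
  have hv : stepWave n k α t y = (fade (k * t - 1) : ℂ) * E
    - (Real.smoothTransition (k * t - -2) : ℂ) * W := rfl
  have hexp : ∀ {x : ℝ}, 1 ≤ x → Real.exp (-x) ≤ 1 / 2 := by
    intro x hx
    have h2 : (2 : ℝ) ≤ Real.exp x := by linarith [Real.add_one_le_exp x]
    rw [Real.exp_neg, inv_eq_one_div]
    exact one_div_le_one_div_of_le (by norm_num) h2
  have hratio : k * t ≤ 2 → W = E * ((Real.exp (k * t) : ℂ)
      * Complex.exp (((2 * n + k) * y + α * saw ((2 * n + k) * y) : ℝ) * Complex.I)) :=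
    wave_eq_holWave_mul
  have hnorm : k * t ≤ 2 → ‖W‖ = ‖E‖ * Real.exp (k * t) := by
    intro h
    rw [hratio h, norm_mul, norm_mul, Complex.norm_exp_ofReal_mul_I, Complex.norm_real,
      Real.norm_eq_abs, abs_of_pos (Real.exp_pos _), mul_one]
  have hE0 := norm_nonneg E
  have hW0 := norm_nonneg W
  have hv0 := norm_nonneg (stepWave n k α t y)
  have bound : ∀ {a b : ℂ} {d : ℝ}, ‖a‖ ≤ D → ‖b‖ ≤ d → ‖a * b‖ ≤ D * d := by
    intro a b d ha hb
    rw [norm_mul]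
    exact mul_le_mul ha hb (norm_nonneg _) hD0
  rcases le_or_gt (k * t) (-1) with hs | hs
  · -- the holomorphic wave dominates
    have hX0 : X = 0 := by
      rw [hX, step₂_of_neg (by linarith), step₁_of_neg (by linarith)]; simp
    have hWE : ‖W‖ ≤ ‖E‖ * (1 / 2) := by
      rw [hnorm (by linarith)]
      have := hexp (x := -(k * t)) (by linarith)
      rw [neg_neg] at this
      exact mul_le_mul_of_nonneg_left this hE0
    have hlow : ‖W‖ ≤ ‖stepWave n k α t y‖ := by
      rw [hv, fade_of_nonpos (by linarith), Complex.ofReal_one, one_mul]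
      have h2 : ‖((Real.smoothTransition (k * t - -2) : ℝ) : ℂ) * W‖ ≤ ‖W‖ := by
        rw [norm_mul, Complex.norm_real, Real.norm_eq_abs,
          abs_of_nonneg (Real.smoothTransition.nonneg _)]
        exact mul_le_of_le_one_left hW0 (Real.smoothTransition.le_one _)
      have h3 := norm_sub_norm_le E (((Real.smoothTransition (k * t - -2) : ℝ) : ℂ) * W)
      linarith
    rw [hX0, zero_mul, zero_sub, norm_neg]
    refine (bound bY hlow).trans (mul_le_mul_of_nonneg_right ?_ hv0)
    linarith
  rcases lt_or_ge (k * t) 1 with hs' | hs'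
  · -- the zone where the two waves may cancel
    have hX0 : X = 0 := by
      rw [hX, step₂_of_neg (by linarith), step₁_of_neg (by linarith)]; simp
    have hYV : Y = V := by
      rw [hY, step₂_of_one_lt (by linarith), step₁_of_one_lt (by linarith),
        Real.smoothTransition.one_of_one_le (by linarith)]
      simp
    rw [hX0, zero_mul, zero_sub, norm_neg, hYV]
    rcases saw_zone_or_cos_le h0 h1 ((2 * n + k) * y) with hz | hz
    · rw [hV, wavePotential_eq_zero hα (by linarith) hz.1 hz.2, zero_mul, norm_zero]
      positivity
    · have hcos : 0 ≤ Real.cos (Real.pi / 12) := by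
        have := Real.pi_pos
        exact Real.cos_nonneg_of_neg_pi_div_two_le_of_le (by linarith) (by linarith)
      have hlow : c * ‖W‖ ≤ ‖stepWave n k α t y‖ := by
        rw [hv, fade_of_nonpos (by linarith), Real.smoothTransition.one_of_one_le (by linarith),
          Complex.ofReal_one, one_mul, one_mul, hnorm (by linarith)]
        have := mul_le_norm_one_sub (Real.exp_pos (k * t)).le hcos hz
        calc c * (‖E‖ * Real.exp (k * t)) = ‖E‖ * (c * Real.exp (k * t)) := by ring
          _ ≤ ‖E‖ * _ := mul_le_mul_of_nonneg_left this hE0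
          _ = ‖E - W‖ := by rw [← norm_mul, mul_sub, mul_one, ← hratio (by linarith)]
      have hlow' : ‖W‖ ≤ ‖stepWave n k α t y‖ / c := by
        rw [le_div_iff₀ hc]; linarith
      refine (bound bV hlow').trans ?_
      have : D * (‖stepWave n k α t y‖ / c) = D / c * ‖stepWave n k α t y‖ := by ring
      rw [this]
      exact mul_le_mul_of_nonneg_right (by linarith) hv0
  have hσ : Real.smoothTransition (k * t - -2) = 1 :=
    Real.smoothTransition.one_of_one_le (by linarith)
  rw [hσ, Complex.ofReal_one, one_mul] at hv
  rcases le_or_gt (k * t) 2 with hs'' | hs''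
  · -- the second wave dominates
    have hEW : ‖E‖ ≤ ‖W‖ * (1 / 2) := by
      have h2 := hexp hs'
      have h3 : ‖E‖ = ‖W‖ * Real.exp (-(k * t)) := by
        rw [hnorm hs'', mul_assoc, ← Real.exp_add]; simp
      rw [h3]
      exact mul_le_mul_of_nonneg_left h2 hW0
    have hlow : ‖W‖ ≤ 2 * ‖stepWave n k α t y‖ := by
      have h2 : ‖(fade (k * t - 1) : ℂ) * E‖ ≤ ‖E‖ := by
        rw [norm_mul, Complex.norm_real, Real.norm_eq_abs]
        exact mul_le_of_le_one_left hE0 (abs_fade_le _)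
      have h3 := norm_sub_norm_le W ((fade (k * t - 1) : ℂ) * E)
      rw [hv, norm_sub_rev]
      linarith
    refine (norm_sub_le _ _).trans ((add_le_add (bound bX (d := ‖stepWave n k α t y‖) ?_)
      (bound bY hlow)).trans ?_)
    · linarith
    · have : 0 ≤ D / c * ‖stepWave n k α t y‖ := by positivity
      linarith
  · have hX0 : X = 0 := by
      rw [hX, step₂_of_one_lt (by linarith), step₁_of_one_lt (by linarith)]; simp
    rw [fade_of_one_le (by linarith), Complex.ofReal_zero, zero_mul, zero_sub] at hv
    rw [hX0, zero_mul, zero_sub, norm_neg]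
    refine (bound bY (d := ‖stepWave n k α t y‖) (by rw [hv, norm_neg])).trans
      (mul_le_mul_of_nonneg_right ?_ hv0)
    linarith

theorem holWave_eq (n : ℝ) (w : ℂ) : holWave n w.re w.im = Complex.exp (-(n : ℂ) * w) := by
  simp [holWave]

theorem holWave_periodic (n : ℕ) :
    Function.Periodic (fun w : ℂ => holWave n w.re w.im) (2 * Real.pi * Complex.I) := by
  intro w
  simp only [holWave_eq]
  rw [Complex.exp_eq_exp_iff_exists_int]
  refine ⟨-(n : ℤ), ?_⟩
  push_cast
  ring

/-- The transition from `exp (-n w)` to a multiple of the conjugate of `exp (-(n + k) w)`. -/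
theorem exists_step : ∃ A : ℝ, 0 < A ∧ ∀ n k : ℕ, 0 < k → 2 * k ≤ n → ∃ s : ℂ → ℂ,
    ContDiff ℝ 2 s ∧ Function.Periodic s (2 * Real.pi * Complex.I) ∧
    (∀ w : ℂ, k * w.re ≤ -2 → s w = Complex.exp (-n * w)) ∧
    (∀ w : ℂ, 3 ≤ k * w.re →
      s w = -Complex.exp (-((n + k : ℕ) : ℂ) * (starRingEnd ℂ) w)) ∧
    ∀ w, ‖Laplacian.laplacian s w‖ ≤ A * ((2 * n + k) * k) * ‖s w‖ := by
  obtain ⟨B, hB⟩ := exists_isProfileBound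
  have hB0 : 0 < B := by linarith [hB.1]
  have hc := sqrt_one_sub_cos_pos
  refine ⟨53 * B ^ 4 * (3 + 1 / Real.sqrt (1 - Real.cos (Real.pi / 12))), by positivity, ?_⟩
  intro n k hk hkn
  have hk' : (0 : ℝ) < k := by exact_mod_cast hk
  have hkn' : (2 : ℝ) * k ≤ n := by exact_mod_cast hkn
  have hP : (0 : ℝ) < 2 * n + k := by positivity
  set α : ℝ := 2 * k / (2 * n + k) with hα
  refine ⟨fun w => stepWave n k α w.re w.im, contDiff_stepWave _ _ _, fun w => ?_,
    fun w hw => ?_, fun w hw => ?_, norm_laplacian_stepWave_le hB (by positivity) hk'.le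
      (div_mul_cancel₀ _ hP.ne') (by positivity) ?_⟩
  · have h1 := holWave_periodic n w
    have h2 := wave_periodic n k α w
    have e' : (w + 2 * Real.pi * Complex.I).re = w.re := by simp
    simp only [stepWave] at *
    rw [h1, h2, e']
  · simp only [stepWave]
    rw [fade_of_nonpos (by linarith), Real.smoothTransition.zero_of_nonpos (by linarith), holWave_eq]
    simp
  · simp only [stepWave]
    rw [fade_of_one_le (by linarith), Real.smoothTransition.one_of_one_le (by linarith),
      wave_of_ge hw]
    simp
  · rw [hα, div_le_iff₀ hP]
    linarith

/-! ### Iterating the transitions -/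

/-- `v` is a function on the cylinder `ℂ / 2πiℤ` solving `Δ v + V v = 0` with `|V| ≤ M`. To the left
of `T₀` it is a harmonic function of `exp w`, and to the right of `T` it is a multiple of
`exp (-n w)`. -/
structure IsTransition (T₀ M : ℝ) (n : ℕ) (T : ℝ) (v : ℂ → ℂ) : Prop where
  contDiff : ContDiff ℝ 2 v
  periodic : Function.Periodic v (2 * Real.pi * Complex.I)
  inner : ∃ p : ℂ → ℂ, ContDiff ℝ 2 p ∧ (∀ z, Laplacian.laplacian p z = 0) ∧
    ∀ w : ℂ, w.re ≤ T₀ → v w = p (Complex.exp w)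
  outer : ∃ c : ℂ, c ≠ 0 ∧ ∀ w : ℂ, T ≤ w.re → v w = c * Complex.exp (-n * w)
  bound : ∀ w, ‖Laplacian.laplacian v w‖ ≤ M * ‖v w‖

theorem laplacian_conj {f : ℂ → ℂ} (hf : ContDiff ℝ 2 f) (w : ℂ) :
    Laplacian.laplacian (fun z => (starRingEnd ℂ) (f z)) w
      = (starRingEnd ℂ) (Laplacian.laplacian f w) :=
  hf.contDiffAt.laplacian_CLM_comp_left (l := (Complex.conjCLE : ℂ →L[ℝ] ℂ))

theorem contDiff_conj {f : ℂ → ℂ} (hf : ContDiff ℝ 2 f) :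
    ContDiff ℝ 2 fun z => (starRingEnd ℂ) (f z) :=
  Complex.conjCLE.contDiff.comp hf

/-- Complex conjugation turns an antiholomorphic right end into a holomorphic one. -/
theorem isTransition_conj {T₀ M : ℝ} {n : ℕ} {T : ℝ} {v : ℂ → ℂ} (hv : ContDiff ℝ 2 v)
    (hper : Function.Periodic v (2 * Real.pi * Complex.I))
    (hin : ∃ p : ℂ → ℂ, ContDiff ℝ 2 p ∧ (∀ z, Laplacian.laplacian p z = 0) ∧
      ∀ w : ℂ, w.re ≤ T₀ → v w = p (Complex.exp w))
    (hout : ∃ c : ℂ, c ≠ 0 ∧ ∀ w : ℂ, T ≤ w.re →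
      v w = c * Complex.exp (-n * (starRingEnd ℂ) w))
    (hbd : ∀ w, ‖Laplacian.laplacian v w‖ ≤ M * ‖v w‖) :
    IsTransition T₀ M n T fun w => (starRingEnd ℂ) (v w) where
  contDiff := contDiff_conj hv
  periodic w := by simp only [hper w]
  inner := by
    obtain ⟨p, hp, hpΔ, hvp⟩ := hin
    refine ⟨fun z => (starRingEnd ℂ) (p z), contDiff_conj hp, fun z => ?_, fun w hw => ?_⟩
    · rw [laplacian_conj hp, hpΔ, map_zero]
    · rw [hvp w hw]
  outer := by
    obtain ⟨c, hc, h⟩ := hout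
    refine ⟨(starRingEnd ℂ) c, by simpa using hc, fun w hw => ?_⟩
    rw [h w hw, map_mul, ← Complex.exp_conj]
    simp
  bound w := by
    rw [laplacian_conj hv, RCLike.norm_conj, RCLike.norm_conj]
    exact hbd w

theorem laplacian_eq_zero_of_differentiable {f : ℂ → ℂ} (hf : Differentiable ℂ f) (z : ℂ) :
    Laplacian.laplacian f z = 0 :=
  ((hf.analyticAt z).harmonicAt).2.self_of_nhds

/-- The first transition, from `z ^ m` to `z̄ ^ (-m)` up to constants and conjugation. -/
theorem exists_isTransition_base : ∃ A : ℝ, 0 < A ∧ ∀ (T₀ M : ℝ) (m : ℕ), 0 < m →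
    A * m ^ 2 ≤ M → ∃ v, IsTransition T₀ M m (T₀ + 3 / m) v := by
  obtain ⟨A, hA, h⟩ := exists_flip
  refine ⟨A, hA, fun T₀ M m hm hM => ?_⟩
  obtain ⟨s, hs, hper, hin, hout, hbd⟩ := h m
  have hm' : (0 : ℝ) < m := by exact_mod_cast hm
  refine ⟨_, isTransition_conj (v := fun w => s (w - T₀)) (hs.comp (contDiff_id.sub contDiff_const))
    (fun w => ?_) ?_ ?_ fun w => ?_⟩
  · simp only
    rw [add_sub_right_comm]
    exact hper _
  · refine ⟨fun z => Complex.exp (-(m * T₀)) * z ^ m, contDiff_const.mul (contDiff_id.pow m),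
      laplacian_eq_zero_of_differentiable (by fun_prop), fun w hw => ?_⟩
    simp only
    rw [hin, ← Complex.exp_nat_mul, ← Complex.exp_add]
    · congr 1
      ring
    · have : (w - T₀).re ≤ 0 := by simpa using hw
      nlinarith
  · refine ⟨Complex.exp (m * T₀), Complex.exp_ne_zero _, fun w hw => ?_⟩
    rw [hout, ← Complex.exp_add]
    · congr 1
      simp
      ring
    · have : 3 / (m : ℝ) ≤ (w - T₀).re := by
        simp only [Complex.sub_re, Complex.ofReal_re]
        linarith
      rw [div_le_iff₀ hm'] at this
      linarith
  · rw [laplacian_comp_sub_const]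
    exact (hbd _).trans (mul_le_mul_of_nonneg_right hM (norm_nonneg _))

/-- Two functions that agree on a strip can be glued along it. -/
theorem exists_glue {f g : ℂ → ℂ} {a b : ℝ}
    (h : ∀ w : ℂ, a < w.re → w.re < b → f w = g w) :
    ∃ F : ℂ → ℂ, (∀ w : ℂ, w.re < b → F w = f w) ∧ ∀ w : ℂ, a < w.re → F w = g w := by
  classical
  refine ⟨fun w => if w.re ≤ a then f w else g w, fun w hw => ?_, fun w hw => ?_⟩
  · by_cases h' : w.re ≤ a
    · simp [h']
    · simp [h', h w (not_le.1 h') hw]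
  · simp [not_le.2 hw]

/-- One step of the construction: on a strip of width `6 / k` the frequency grows by `k`. -/
theorem exists_isTransition_step : ∃ A : ℝ, 0 < A ∧ ∀ (T₀ M T : ℝ) (n k : ℕ) (v : ℂ → ℂ), 0 < k →
    2 * k ≤ n → A * ((2 * n + k) * k) ≤ M → T₀ ≤ T → IsTransition T₀ M n T v →
    ∃ v', IsTransition T₀ M (n + k) (T + 6 / k) v' := by
  obtain ⟨A, hA, h⟩ := exists_step
  refine ⟨A, hA, fun T₀ M T n k v hk hkn hM hT hv => ?_⟩
  obtain ⟨s, hs, hsper, hin, hout, hbd⟩ := h n k hk hkn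
  obtain ⟨c, hc, hvc⟩ := hv.outer
  have hk' : (0 : ℝ) < k := by exact_mod_cast hk
  have hk1 : (0 : ℝ) < 1 / k := by positivity
  set a : ℝ := T + 3 / k with ha
  set d : ℂ := c * Complex.exp (-(n * a)) with hd
  have hd0 : d ≠ 0 := mul_ne_zero hc (Complex.exp_ne_zero _)
  -- the transition, moved so that it starts at `T` as a multiple of `exp (-n w)`
  set g : ℂ → ℂ := fun w => d • s (w - a) with hg
  have hgC : ContDiff ℝ 2 g :=
    (hs.comp (contDiff_id.sub contDiff_const)).const_smul d
  have hgΔ : ∀ w, Laplacian.laplacian g w = d * Laplacian.laplacian s (w - a) := by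
    intro w
    have h1 : ContDiffAt ℝ 2 (fun w : ℂ => s (w - a)) w :=
      (hs.comp (contDiff_id.sub contDiff_const)).contDiffAt
    have := InnerProductSpace.laplacian_smul d h1
    rw [laplacian_comp_sub_const] at this
    exact this
  have hagree : ∀ w : ℂ, T < w.re → w.re < T + 1 / k → v w = g w := by
    intro w h1 h2
    have h3 : (k : ℝ) * (w - a).re ≤ -2 := by
      have : (w - a).re ≤ -(2 / k) := by
        simp only [Complex.sub_re, Complex.ofReal_re, ha]
        have e : (3 : ℝ) / k = 1 / k + 2 / k := by ring
        linarith
      calc (k : ℝ) * (w - a).re ≤ k * -(2 / k) := mul_le_mul_of_nonneg_left this hk'.le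
        _ = -2 := by field_simp
    rw [hvc w h1.le, hg]
    simp only [smul_eq_mul]
    rw [hin _ h3, hd, mul_assoc, ← Complex.exp_add]
    congr 2
    ring
  obtain ⟨F, hF1, hF2⟩ := exists_glue hagree
  have near1 : ∀ w : ℂ, w.re < T + 1 / k → F =ᶠ[nhds w] v := fun w hw => by
    filter_upwards [(isOpen_lt Complex.continuous_re continuous_const).mem_nhds hw] with y hy
      using hF1 y hy
  have near2 : ∀ w : ℂ, T < w.re → F =ᶠ[nhds w] g := fun w hw => by
    filter_upwards [(isOpen_lt continuous_const Complex.continuous_re).mem_nhds hw] with y hy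
      using hF2 y hy
  have hcases : ∀ w : ℂ, w.re < T + 1 / k ∨ T < w.re := fun w => by
    rcases lt_or_ge w.re (T + 1 / k) with h | h
    · exact Or.inl h
    · exact Or.inr (by linarith)
  refine ⟨_, isTransition_conj (v := F) (contDiff_iff_contDiffAt.2 fun w => ?_) (fun w => ?_) ?_ ?_
    fun w => ?_⟩
  · rcases hcases w with hw | hw
    · exact hv.contDiff.contDiffAt.congr_of_eventuallyEq (near1 w hw)
    · exact hgC.contDiffAt.congr_of_eventuallyEq (near2 w hw)
  · have e : (w + 2 * Real.pi * Complex.I).re = w.re := by simp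
    rcases hcases w with hw | hw
    · rw [hF1 w hw, hF1 _ (by rwa [e]), hv.periodic]
    · rw [hF2 w hw, hF2 _ (by rwa [e]), hg]
      simp only
      rw [add_sub_right_comm, hsper]
  · obtain ⟨p, hp, hpΔ, hvp⟩ := hv.inner
    exact ⟨p, hp, hpΔ, fun w hw => by rw [hF1 w (by linarith), hvp w hw]⟩
  · refine ⟨-(d * Complex.exp ((n + k : ℕ) * a)),
      neg_ne_zero.2 (mul_ne_zero hd0 (Complex.exp_ne_zero _)), fun w hw => ?_⟩
    have h6 : (6 : ℝ) / k = 3 / k + 3 / k := by ring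
    have h3 : (3 : ℝ) ≤ k * (w - a).re := by
      have : 3 / (k : ℝ) ≤ (w - a).re := by
        simp only [Complex.sub_re, Complex.ofReal_re, ha]
        linarith
      rw [div_le_iff₀ hk'] at this
      linarith
    have h0 : (0 : ℝ) < 6 / k := by positivity
    rw [hF2 w (by linarith), hg]
    simp only [smul_eq_mul]
    have hexp : -((n + k : ℕ) : ℂ) * (starRingEnd ℂ) (w - a)
        = (n + k : ℕ) * a + -((n + k : ℕ) : ℂ) * (starRingEnd ℂ) w := by
      rw [map_sub, Complex.conj_ofReal]
      ring
    rw [hout _ h3, hexp, Complex.exp_add]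
    ring
  · rcases hcases w with hw | hw
    · rw [(InnerProductSpace.laplacian_congr_nhds (near1 w hw)).self_of_nhds, hF1 w hw]
      exact hv.bound w
    · rw [(InnerProductSpace.laplacian_congr_nhds (near2 w hw)).self_of_nhds, hF2 w hw, hgΔ, hg]
      simp only [smul_eq_mul, norm_mul]
      have h1 := (hbd (w - a)).trans (mul_le_mul_of_nonneg_right hM (norm_nonneg _))
      have := mul_le_mul_of_nonneg_left h1 (norm_nonneg d)
      linarith

/-- After about `N / k` steps of size `k`, with `k` of the order of `√N`, the frequency is `N`; the
total width of the strips stays below `1 / 4`. -/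
theorem exists_isTransition : ∃ C : ℝ, 0 < C ∧ ∀ (T₀ : ℝ) (N : ℕ), 900 ≤ N →
    ∃ v, IsTransition T₀ (C * (N : ℝ) ^ (3 / 2 : ℝ)) N (T₀ + 1 / 4) v := by
  obtain ⟨A₁, hA₁, hbase⟩ := exists_isTransition_base
  obtain ⟨A₂, hA₂, hstep⟩ := exists_isTransition_step
  refine ⟨3600 * A₁ + 60 * A₂, by positivity, fun T₀ N hN => ?_⟩
  set M := (3600 * A₁ + 60 * A₂) * (N : ℝ) ^ (3 / 2 : ℝ) with hM
  set K := Nat.sqrt N with hK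
  have hK1 : K * K ≤ N := Nat.sqrt_le N
  have hK2 : N < (K + 1) * (K + 1) := Nat.lt_succ_sqrt N
  have hK3 : 30 ≤ K := Nat.le_sqrt.2 hN
  set k := 10 * (K + 1) with hk
  have hk0 : 0 < k := by positivity
  have h2k : 2 * k ≤ N := by nlinarith
  have hN0 : (0 : ℝ) ≤ N := Nat.cast_nonneg N
  have hN1 : (1 : ℝ) ≤ N := by exact_mod_cast (by omega : 1 ≤ N)
  have hkR : (0 : ℝ) < k := by exact_mod_cast hk0
  have hsq : (K : ℝ) ≤ Real.sqrt N := by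
    rw [Real.le_sqrt (by positivity) hN0, sq]
    exact_mod_cast hK1
  have hks : (k : ℝ) ≤ 20 * Real.sqrt N := by
    have : (1 : ℝ) ≤ K := by exact_mod_cast (by omega : 1 ≤ K)
    rw [hk]
    push_cast
    linarith
  have hpow : (N : ℝ) ^ (3 / 2 : ℝ) = N * Real.sqrt N := by
    rw [Real.sqrt_eq_rpow, ← Real.rpow_one_add' hN0 (by norm_num)]
    norm_num
  have hsqrt1 : 1 ≤ Real.sqrt N := Real.one_le_sqrt.2 hN1
  -- all steps have the same size `k`, so the initial frequency absorbs the remainder of `N`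
  set n₀ := 2 * k + N % k with hn₀
  have hmod : N % k < k := Nat.mod_lt _ hk0
  have hn₀k : (n₀ : ℝ) ≤ 3 * k := by exact_mod_cast (by omega : n₀ ≤ 3 * k)
  have hM₁ : A₁ * (n₀ : ℝ) ^ 2 ≤ M := by
    have h1 : (n₀ : ℝ) ^ 2 ≤ (60 * Real.sqrt N) ^ 2 :=
      pow_le_pow_left₀ (Nat.cast_nonneg _) (by linarith) 2
    have h2 : (60 * Real.sqrt N) ^ 2 = 3600 * N := by
      rw [mul_pow, Real.sq_sqrt hN0]; norm_num
    have h3 : (N : ℝ) ≤ N * Real.sqrt N := le_mul_of_one_le_right hN0 hsqrt1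
    have h4 : A₁ * (n₀ : ℝ) ^ 2 ≤ A₁ * (3600 * (N * Real.sqrt N)) :=
      mul_le_mul_of_nonneg_left (by linarith) hA₁.le
    have h5 : 0 ≤ A₂ * (N * Real.sqrt N) := by positivity
    rw [hM, hpow]
    linarith
  have hM₂ : ∀ n : ℕ, n + k ≤ N → A₂ * ((2 * n + k) * k) ≤ M := by
    intro n hn
    have hn' : (n : ℝ) + k ≤ N := by exact_mod_cast hn
    have h1 : (2 * (n : ℝ) + k) * k ≤ 3 * N * (20 * Real.sqrt N) :=
      mul_le_mul (by linarith) hks hkR.le (by positivity)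
    have h4 : A₂ * ((2 * (n : ℝ) + k) * k) ≤ A₂ * (60 * (N * Real.sqrt N)) :=
      mul_le_mul_of_nonneg_left (by linarith) hA₂.le
    have h5 : 0 ≤ A₁ * (N * Real.sqrt N) := by positivity
    rw [hM, hpow]
    linarith
  have chain : ∀ j : ℕ, n₀ + k * j ≤ N →
      ∃ v, IsTransition T₀ M (n₀ + k * j) (T₀ + 3 / n₀ + 6 / k * j) v := by
    intro j
    induction j with
    | zero =>
      intro _
      obtain ⟨v, hv⟩ := hbase T₀ M n₀ (by omega) hM₁
      exact ⟨v, by simpa using hv⟩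
    | succ j ih =>
      intro hj
      have hj' : n₀ + k * j + k ≤ N := by linarith
      obtain ⟨v, hv⟩ := ih (by omega)
      obtain ⟨v', hv'⟩ := hstep T₀ M _ _ k v hk0 (by omega) (hM₂ _ hj')
        (by rw [add_assoc]; exact le_add_of_nonneg_right (by positivity)) hv
      refine ⟨v', ?_⟩
      convert hv' using 1 <;> push_cast <;> ring
  have hdiv : k * (N / k) + N % k = N := Nat.div_add_mod N k
  have hq2 : 2 ≤ N / k := (Nat.le_div_iff_mul_le hk0).2 h2k
  obtain ⟨j, hj⟩ := Nat.exists_eq_add_of_le hq2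
  have hend : n₀ + k * j = N := by
    rw [hj] at hdiv
    rw [hn₀]
    linarith
  obtain ⟨v, hv⟩ := chain j hend.le
  rw [hend] at hv
  refine ⟨v, hv.contDiff, hv.periodic, hv.inner, ?_, hv.bound⟩
  obtain ⟨c, hc, h⟩ := hv.outer
  refine ⟨c, hc, fun w hw => h w (le_trans ?_ hw)⟩
  have hkN : (100 : ℝ) * N ≤ k * k := by
    have : 100 * N ≤ k * k := by nlinarith
    exact_mod_cast this
  have hn₀' : 2 * (k : ℝ) ≤ n₀ := by exact_mod_cast (by omega : 2 * k ≤ n₀)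
  have hjN : (j : ℝ) * k ≤ N := by exact_mod_cast (by nlinarith : j * k ≤ N)
  have hk300 : (300 : ℝ) ≤ k := by exact_mod_cast (by omega : 300 ≤ k)
  have e1 : 3 / (n₀ : ℝ) ≤ 1 / 100 := by
    rw [div_le_div_iff₀ (by linarith) (by norm_num)]
    linarith
  have e2 : 6 / (k : ℝ) * j ≤ 6 / 100 := by
    rw [div_mul_eq_mul_div, div_le_div_iff₀ hkR (by norm_num)]
    have : (100 * j) * (k : ℝ) ≤ k * k := by linarith
    have := le_of_mul_le_mul_right this hkR
    linarith
  linarith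

/-! ### The solution in the plane -/

theorem mainTheorem6 :
    ∃ (C C₁ C₂ ρ₀ : ℝ) (N₀ : ℕ), 0 < C ∧ 0 < C₁ ∧ 0 < C₂ ∧ 0 < ρ₀ ∧
      ∀ ρ : ℝ, ρ₀ ≤ ρ → ∀ N : ℕ, N₀ ≤ N →
        ∃ u W : EuclideanSpace ℝ (Fin 2) → ℂ,
          ContDiff ℝ 2 u ∧ Measurable W ∧
          (∀ x, Laplacian.laplacian u x + W x * u x = 0) ∧
          (∀ x, ρ + 6 ≤ ‖x‖ →
            C₂ * ‖x‖ ^ (-(N : ℤ)) ≤ ‖u x‖ ∧ ‖u x‖ ≤ C₁ * ‖x‖ ^ (-(N : ℤ))) ∧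
          eLpNorm W ∞ volume ≤ ENNReal.ofReal (C * (N : ℝ) ^ (3 / 2 : ℝ)) ∧
          tsupport W ⊆ {x | ρ / 2 < ‖x‖ ∧ ‖x‖ ≤ ρ + 6} := by
  obtain ⟨C, hC, hex⟩ := exists_isTransition
  refine ⟨C, 1, 1, 2, 900, hC, one_pos, one_pos, two_pos, fun ρ hρ N hN => ?_⟩
  have hR : 0 < 3 * ρ / 4 := by linarith
  set T₀ := Real.log (3 * ρ / 4) with hT₀
  have hexp₀ : Real.exp T₀ = 3 * ρ / 4 := Real.exp_log hR
  -- the ratio `4 / 3` of the radii `ρ` and `3 ρ / 4` exceeds `exp (1 / 4)`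
  have hexp₁ : Real.exp (T₀ + 1 / 4) ≤ ρ := by
    have h1 : 1 - 1 / 4 ≤ Real.exp (-(1 / 4)) := Real.one_sub_le_exp_neg _
    have h2 : Real.exp (T₀ + 1 / 4) * Real.exp (-(1 / 4)) = 3 * ρ / 4 := by
      rw [← Real.exp_add, add_neg_cancel_right, hexp₀]
    nlinarith [Real.exp_pos (T₀ + 1 / 4)]
  obtain ⟨v, hv⟩ := hex T₀ N hN
  obtain ⟨p, hp, hpΔ, hvp⟩ := hv.inner
  obtain ⟨c, hc, hout⟩ := hv.outer
  set M := C * (N : ℝ) ^ (3 / 2 : ℝ) with hM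
  have hM0 : 0 ≤ M := by positivity
  obtain ⟨u, hu, huv, hin, hΔ⟩ := exists_plane_function hv.contDiff hv.periodic hp hpΔ hvp
  have hlog : ∀ z : ℂ, z ≠ 0 → ρ ≤ ‖z‖ → T₀ + 1 / 4 ≤ (Complex.log z).re := fun z hz h => by
    rw [Complex.log_re, Real.le_log_iff_exp_le (norm_pos_iff.2 hz)]
    linarith
  -- the potential is bounded: outside the disc the conformal factor is at most `1`
  have hbound : ∀ z, ‖Laplacian.laplacian u z‖ ≤ M * ‖u z‖ := by
    intro z
    rcases lt_or_ge ‖z‖ (Real.exp T₀) with h | h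
    · rw [hin z h, norm_zero]
      positivity
    · have hz1 : 1 ≤ ‖z‖ := by linarith
      have hz : z ≠ 0 := norm_pos_iff.1 (by linarith)
      rw [hΔ z hz, huv z hz, norm_mul, Complex.norm_real, Real.norm_eq_abs,
        abs_of_nonneg (by positivity)]
      exact (mul_le_of_le_one_left (norm_nonneg _)
        (inv_le_one_of_one_le₀ (one_le_pow₀ hz1))).trans (hv.bound _)
  have houter : ∀ z, ρ < ‖z‖ → Laplacian.laplacian u z = 0 := by
    intro z h
    have hnear : u =ᶠ[nhds z] fun y => c * (y ^ N)⁻¹ := by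
      filter_upwards [(isOpen_lt continuous_const continuous_norm).mem_nhds h] with y hy
      have hy' : ρ < ‖y‖ := hy
      have hy0 : y ≠ 0 := norm_pos_iff.1 (by linarith)
      rw [huv y hy0, hout _ (hlog y hy0 hy'.le), neg_mul, Complex.exp_neg, Complex.exp_nat_mul,
        Complex.exp_log hy0]
    have hz : z ≠ 0 := norm_pos_iff.1 (by linarith)
    have han : AnalyticAt ℂ (fun y : ℂ => c * (y ^ N)⁻¹) z :=
      analyticAt_const.mul ((analyticAt_id.pow N).inv (pow_ne_zero N hz))
    rw [(InnerProductSpace.laplacian_congr_nhds hnear).self_of_nhds]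
    exact han.harmonicAt.2.self_of_nhds
  set e : EuclideanSpace ℝ (Fin 2) ≃ₗᵢ[ℝ] ℂ := Complex.orthonormalBasisOneI.repr.symm with he
  have hcu : ContDiff ℝ 2 (c⁻¹ • u) := hu.const_smul c⁻¹
  set U : EuclideanSpace ℝ (Fin 2) → ℂ := fun x => (c⁻¹ • u) (e x) with hU
  have hUC : ContDiff ℝ 2 U := hcu.comp e.contDiff
  have hUΔ : ∀ x, Laplacian.laplacian U x = c⁻¹ * Laplacian.laplacian u (e x) := fun x => by
    rw [hU, laplacian_comp_linearIsometryEquiv e hcu x]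
    exact InnerProductSpace.laplacian_smul c⁻¹ hu.contDiffAt
  have hUbound : ∀ x, ‖Laplacian.laplacian U x‖ ≤ M * ‖U x‖ := fun x => by
    have := mul_le_mul_of_nonneg_left (hbound (e x)) (norm_nonneg c⁻¹)
    rw [hUΔ, hU]
    simp only [Pi.smul_apply, smul_eq_mul, norm_mul]
    linarith
  have hΔC := continuous_laplacian hUC
  refine ⟨U, fun x => -(Laplacian.laplacian U x / U x), hUC,
    (hΔC.measurable.div hUC.continuous.measurable).neg, fun x => ?_, fun x hx => ?_, ?_, ?_⟩
  · -- at a zero of `U` the Laplacian vanishes as well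
    by_cases h0 : U x = 0
    · have := hUbound x
      rw [h0, norm_zero, mul_zero] at this
      rw [norm_le_zero_iff.1 this, h0]
      simp
    · field_simp
      ring
  · have hn : ‖e x‖ = ‖x‖ := e.norm_map x
    have hx0 : e x ≠ 0 := norm_pos_iff.1 (by linarith)
    have hUx : ‖U x‖ = ‖x‖ ^ (-(N : ℤ)) := by
      rw [hU]
      simp only [Pi.smul_apply, smul_eq_mul]
      rw [huv _ hx0, hout _ (hlog _ hx0 (by linarith)), inv_mul_cancel_left₀ hc, neg_mul,
        Complex.exp_neg, Complex.exp_nat_mul, Complex.exp_log hx0, norm_inv, norm_pow, hn,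
        zpow_neg, zpow_natCast]
    rw [hUx, one_mul]
    exact ⟨le_rfl, le_rfl⟩
  · rw [eLpNorm_exponent_top]
    refine eLpNormEssSup_le_of_ae_bound (Filter.Eventually.of_forall fun x => ?_)
    rw [norm_neg, norm_div]
    exact div_le_of_le_mul₀ (norm_nonneg _) hM0 (hUbound x)
  · have hclosed : IsClosed {x : EuclideanSpace ℝ (Fin 2) | 3 * ρ / 4 ≤ ‖x‖ ∧ ‖x‖ ≤ ρ} :=
      (isClosed_le continuous_const continuous_norm).inter
        (isClosed_le continuous_norm continuous_const)
    have hsub : tsupport (fun x => -(Laplacian.laplacian U x / U x))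
        ⊆ {x : EuclideanSpace ℝ (Fin 2) | 3 * ρ / 4 ≤ ‖x‖ ∧ ‖x‖ ≤ ρ} := by
      refine closure_minimal (fun x hx => ?_) hclosed
      have hne : Laplacian.laplacian u (e x) ≠ 0 := by
        intro h0
        apply hx
        simp only [hUΔ, h0, mul_zero, zero_div, neg_zero]
      have hn : ‖e x‖ = ‖x‖ := e.norm_map x
      constructor
      · by_contra hlt
        exact hne (hin _ (by rw [hexp₀, hn]; exact not_le.1 hlt))
      · by_contra hlt
        exact hne (houter _ (by rw [hn]; exact not_le.1 hlt))
    refine hsub.trans fun x hx => ?_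
    obtain ⟨h1, h2⟩ : 3 * ρ / 4 ≤ ‖x‖ ∧ ‖x‖ ≤ ρ := hx
    exact ⟨by linarith, by linarith⟩
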